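/- **Setting.** Let $n\ge 1$, let $\Omega\subset\mathbb R^n$ be a bounded open set with $C^1$ boundary $\partial\Omega=\Gamma_u\cup\Gamma_t$ ($\Gamma_u,\Gamma_t$ measurable), let $\nu,\lambda>0$, $p,q\in[2,\infty]$ with conjugate exponents $p',q'$, $f\in L^{p'}(\Omega)$ and $t\in L^{q'}(\Gamma_t)$. A function $u\in L^p(\Omega)$ with weak gradient $\nabla u\in L^4(\Omega)^n$ is called *admissible* if its boundary trace vanishes on $\Gamma_u$ and lies in $L^q(\Gamma_t)$. For a relatively open $D\subset\overline\Omega$, a field $\tau\in L^{4/3}(\Omega\cap D)^n$ is said to solve $\nabla\cdot\tau+f=0$ in $\Omega$, $\tau\cdot\vec n=t$ on $\Gamma_t$, weakly on $D$, if $$\int_{\Omega\cap D}\tau\cdot\nabla\varphi\,dx=\int_{\Omega\cap D}f\varphi\,dx+\int_{\Gamma_t}t\varphi\,d\Gamma$$ for every admissible $\varphi$ which, together with $\nabla\varphi$, vanishes a.e. on $\Omega\setminus D$. Let $\vec\sigma:\mathbb R^n\to\mathbb R^n$ be a vector field that solves this problem weakly on $\overline\Omega$. Put $$P_n(u)=\int_\Omega\frac\nu2\Big(\frac12|\nabla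 u|^2-\lambda\Big)^2dx-\int_\Omega fu\,dx-\int_{\Gamma_t}tu\,d\Gamma,$$ $$\Xi(u,\zeta)=\int_\Omega\Big\{\frac12|\nabla u|^2\zeta-\frac{\zeta^2}{2\nu}-\lambda\zeta-fu\Big\}dx-\int_{\Gamma_t}tu\,d\Gamma,\qquad P_n^d(\zeta)=-\frac12\int_\Omega\Big(\frac{|\vec\sigma|^2}{\zeta}+2\lambda\zeta+\frac{\zeta^2}{\nu}\Big)dx .$$ With principal values of all roots and powers, let $$\omega=\Big(-4\nu^3\lambda^3+27\nu|\vec\sigma|^2+3\sqrt3\sqrt{-8\nu^4\lambda^3|\vec\sigma|^2+27\nu^2|\vec\sigma|^4}\Big)^{1/3},$$ $$\zeta_1=\tfrac13\Big(-\nu\lambda+\sqrt[3]4\,\nu^2\lambda^2\omega^{-1}+4^{-1/3}\omega\Big),$$ $$\zeta_{2}=-\tfrac{\nu\lambda}3-\tfrac13 2^{-1/3}(1- i\sqrt3)\nu^2\lambda^2\omega^{-1}-\tfrac16 4^{-1/3}(1+ i\sqrt3)\,\omega,$$ $$\zeta_{3}=-\tfrac{\nu\lambda}3-\tfrac13 2^{-1/3}(1+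 i\sqrt3)\nu^2\lambda^2\omega^{-1}-\tfrac16 4^{-1/3}(1- i\sqrt3)\,\omega .$$ For $i=1,2,3$ let $\mathcal S_i$ be the set of points $x\in\overline\Omega$ at which $\zeta_i$ is real and nonzero, the field $F_i=\vec\sigma\,\zeta_i^{-1}$ is differentiable (relative to $\overline\Omega$), and $\partial_j(F_i)_k-\partial_k(F_i)_j=0$ for all $j,k$. On $\mathcal S_i$ write $\bar\zeta_i=\zeta_i$. **Theorem.** 1. For every $x\in\overline\Omega$ the complex solutions $\zeta$ of $|\vec\sigma(x)|^2=2\zeta^2(\lambda+\zeta/\nu)$ are exactly $\zeta_1(x),\zeta_2(x),\zeta_3(x)$; in particular there are at most three real solutions. Always $\zeta_1(x)$ is real and $\zeta_1(x)\ge0$; if $\zeta_2(x)$ is real, then $0\ge\zeta_2(x)\ge-2\nu\lambda/3$; if $\zeta_3(x)$ is real, then $-2\nu\lambda/3\ge\zeta_3(x)\ge-\nu\lambda$. If $|\vec\sigma(x)|^2\le 8\lambda^3\nu^2/27$, then all three are real, so that $\zeta_1(x)\ge0\ge\zeta_2(x)\ge-2\nu\lambda/3\ge\zeta_3(x)\ge-\nu\lambda$.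 2. Let $i\in\{1,2,3\}$, let $D\subset\mathcal S_i$ be relatively open in $\overline\Omega$ with $D\cap\Omega$ connected, and let $x_0\in D$, $c\in\mathbb R$. If $D\cap\Omega$ is simply connected (for instance if $\Omega$ is simply connected and $D=\mathcal S_i=\overline\Omega$), then the path integral $\int_{x_0}^x\vec\sigma\,\bar\zeta_i^{-1}\cdot ds$ along piecewise $C^1$ paths in $D$ depends only on $x$. Whenever this integral is independent of the path in $D$, the function $$\bar u_i(x)=\int_{x_0}^x\vec\sigma\,\bar\zeta_i^{-1}\cdot ds+c ,\qquad x\in D,$$ satisfies $\bar u_i(x_0)=c$, is $C^1$ in $D\cap\Omega$, and solves weakly on $D$ the nonlinear boundary value problem $$\nabla\cdot\Big(\nu\big(\tfrac12|\nabla \bar u_i|^2-\lambda\big)\nabla \bar u_i\Big)+f=0\ \text{ in }\Omega,\qquad \nu\big(\tfrac12|\nabla\bar u_i|^2-\lambda\big)\nabla\bar u_i\cdot\vec n=t\ \text{ on }\Gamma_t,$$ as well as $\nabla\cdot(\bar\zeta_i\nabla\bar u_i)+f=0$ in $\Omega$, $\bar\zeta_i\nabla\bar u_i\cdot\vec n=t$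 on $\Gamma_t$. 3. If moreover $\Omega\subset D$ and $\bar u_i$ is admissible (i.e. lies in the domain of $P_n$), then the integrands $\frac\nu2(\frac12|\nabla\bar u_i|^2-\lambda)^2$ and $|\vec\sigma|^2/\bar\zeta_i+2\lambda\bar\zeta_i+\bar\zeta_i^2/\nu$ are integrable over $\Omega$, and there is no duality gap: $$P_n(\bar u_i)=\Xi(\bar u_i,\bar\zeta_i)=P_n^d(\bar\zeta_i).$$ -/

import Mathlib

open Set MeasureTheory Filter Topology
open scoped ENNReal ContDiff

noncomputable section

/-- The Euclidean space `ℝⁿ`. -/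
abbrev Eucl (n : ℕ) : Type := EuclideanSpace ℝ (Fin n)

/-- Surface measure: the `(n-1)`-dimensional Hausdorff measure of `ℝⁿ`, normalized so that it
agrees with Lebesgue measure on `(n-1)`-planes. -/
def surfaceMeasure (n : ℕ) : Measure (Eucl n) :=
  Measure.euclideanHausdorffMeasure (n - 1)

/-- The open set `Ω` has a `C¹` boundary: near each boundary point, `Ω` is the negativity set of a
`C¹` function with nonvanishing derivative. -/
def HasC1Boundary {n : ℕ} (Ω : Set (Eucl n)) : Prop :=
  ∀ x ∈ frontier Ω, ∃ V : Set (Eucl n), IsOpen V ∧ x ∈ V ∧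
    ∃ ρ : Eucl n → ℝ, ContDiffOn ℝ 1 ρ V ∧ (∀ y ∈ V, fderiv ℝ ρ y ≠ 0) ∧
      Ω ∩ V = {y ∈ V | ρ y < 0}

/-! ### Function spaces -/

/-- `G` is the weak (distributional) gradient of `u` on the open set `Ω`. -/
def IsWeakGradient {n : ℕ} (Ω : Set (Eucl n)) (u : Eucl n → ℝ) (G : Eucl n → Eucl n) : Prop :=
  LocallyIntegrableOn u Ω ∧ LocallyIntegrableOn G Ω ∧
    ∀ φ : Eucl n → ℝ, ContDiff ℝ ∞ φ → HasCompactSupport φ → tsupport φ ⊆ Ω →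
      ∫ x in Ω, u x • gradient φ x = -∫ x in Ω, φ x • G x

/-- `g` is the boundary trace on `∂Ω` of the function `u` with weak gradient `G`: some sequence of
`C¹` functions on `ℝⁿ` converges to `u` in `W^{1,1}(Ω)` and its restrictions to `∂Ω` converge to `g`
in `L¹(∂Ω)`. -/
def IsTrace {n : ℕ} (Ω : Set (Eucl n)) (u : Eucl n → ℝ) (G : Eucl n → Eucl n)
    (g : Eucl n → ℝ) : Prop :=
  MemLp g 1 ((surfaceMeasure n).restrict (frontier Ω)) ∧
  ∃ φ : ℕ → Eucl n → ℝ, (∀ k, ContDiff ℝ 1 (φ k)) ∧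
    Tendsto (fun k => eLpNorm (fun x => φ k x - u x) 1 (volume.restrict Ω)) atTop (𝓝 0) ∧
    Tendsto (fun k => eLpNorm (fun x => gradient (φ k) x - G x) 1 (volume.restrict Ω))
      atTop (𝓝 0) ∧
    Tendsto (fun k => eLpNorm (fun x => φ k x - g x) 1
      ((surfaceMeasure n).restrict (frontier Ω))) atTop (𝓝 0)

/-- `u`, with weak gradient `G` and boundary trace `g`, is a kinematically admissible function:
`u ∈ Lᵖ(Ω)`, `∇u ∈ L⁴(Ω)ⁿ`, `u = 0` on `Γu`, and `u|_Γt ∈ L^q(Γt)`. -/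
structure IsAdmissible {n : ℕ} (Ω Γu Γt : Set (Eucl n)) (p q : ℝ≥0∞)
    (u : Eucl n → ℝ) (G : Eucl n → Eucl n) (g : Eucl n → ℝ) : Prop where
  memLp : MemLp u p (volume.restrict Ω)
  weakGradient : IsWeakGradient Ω u G
  gradient_memLp : MemLp G 4 (volume.restrict Ω)
  trace : IsTrace Ω u G g
  dirichlet : g =ᵐ[(surfaceMeasure n).restrict Γu] 0
  trace_memLp : MemLp g q ((surfaceMeasure n).restrict Γt)

/-! ### Boundary value problems and energies -/

/-- The field `τ ∈ L^{4/3}` is a weak solution, on the part `D` of `closure Ω`, of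
`div τ + f = 0` in `Ω`, `τ · n = t` on `Γt`. The test functions are the admissible functions that
vanish off `D` together with their gradients. For `D = closure Ω` this is the full problem. -/
def SolvesDivBVP {n : ℕ} (Ω Γu Γt : Set (Eucl n)) (p q : ℝ≥0∞) (f t : Eucl n → ℝ)
    (D : Set (Eucl n)) (τ : Eucl n → Eucl n) : Prop :=
  MemLp τ (4 / 3) (volume.restrict (Ω ∩ D)) ∧
  ∀ (φ : Eucl n → ℝ) (Gφ : Eucl n → Eucl n) (gφ : Eucl n → ℝ),
    IsAdmissible Ω Γu Γt p q φ Gφ gφ →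
    (∀ᵐ x ∂(volume.restrict (Ω \ D)), φ x = 0 ∧ Gφ x = 0) →
    ∫ x in Ω ∩ D, inner ℝ (τ x) (Gφ x) =
      (∫ x in Ω ∩ D, f x * φ x) + ∫ x in Γt, t x * gφ x ∂(surfaceMeasure n)

/-- The double-well potential `W(y) = (ν/2) (|y|²/2 - lam)²`. -/
def doubleWell {n : ℕ} (ν lam : ℝ) (y : Eucl n) : ℝ :=
  ν / 2 * (‖y‖ ^ 2 / 2 - lam) ^ 2

/-- The stress `DW(y) = ν (|y|²/2 - lam) y`. -/
def stress {n : ℕ} (ν lam : ℝ) (y : Eucl n) : Eucl n :=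
  (ν * (‖y‖ ^ 2 / 2 - lam)) • y

/-- The primal energy `P_n(u) = ∫_Ω W(∇u) - ∫_Ω f u - ∫_Γt t u`, for `u` with weak gradient `G` and
trace `g`. -/
def primalEnergy {n : ℕ} (Ω Γt : Set (Eucl n)) (ν lam : ℝ) (f t : Eucl n → ℝ)
    (u : Eucl n → ℝ) (G : Eucl n → Eucl n) (g : Eucl n → ℝ) : ℝ :=
  (∫ x in Ω, doubleWell ν lam (G x)) - (∫ x in Ω, f x * u x)
    - ∫ x in Γt, t x * g x ∂(surfaceMeasure n)

/-- The total complementary energy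
`Ξ(u, ζ) = ∫_Ω ((|∇u|²/2) ζ - U*(ζ) - f u) - ∫_Γt t u`, where `U*(ζ) = ζ²/(2ν) + lam ζ`. -/
def totalComplementaryEnergy {n : ℕ} (Ω Γt : Set (Eucl n)) (ν lam : ℝ) (f t : Eucl n → ℝ)
    (u : Eucl n → ℝ) (G : Eucl n → Eucl n) (g : Eucl n → ℝ) (ζ : Eucl n → ℝ) : ℝ :=
  (∫ x in Ω, (‖G x‖ ^ 2 / 2 * ζ x - (ζ x ^ 2 / (2 * ν) + lam * ζ x) - f x * u x))
    - ∫ x in Γt, t x * g x ∂(surfaceMeasure n)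

/-- The density `|σ|²/ζ + 2 lam ζ + ζ²/ν`. -/
def dualDensity {n : ℕ} (ν lam : ℝ) (σ : Eucl n → Eucl n) (ζ : Eucl n → ℝ) (x : Eucl n) : ℝ :=
  ‖σ x‖ ^ 2 / ζ x + 2 * lam * ζ x + ζ x ^ 2 / ν

/-- The pure complementary energy `P_n^d(ζ) = -(1/2) ∫_Ω (|σ|²/ζ + 2 lam ζ + ζ²/ν)`. -/
def dualEnergy {n : ℕ} (Ω : Set (Eucl n)) (ν lam : ℝ) (σ : Eucl n → Eucl n)
    (ζ : Eucl n → ℝ) : ℝ :=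
  -(1 / 2) * ∫ x in Ω, dualDensity ν lam σ ζ x

/-! ### The roots of the cubic -/

/-- `ω(ν, lam, σ)` with `s = |σ|²`; all roots are principal. -/
def dualOmega (ν lam s : ℝ) : ℂ :=
  (-4 * (ν : ℂ) ^ 3 * (lam : ℂ) ^ 3 + 27 * (ν : ℂ) * (s : ℂ)
    + 3 * ((3 : ℂ) ^ (1 / 2 : ℂ)) *
      (-8 * (ν : ℂ) ^ 4 * (lam : ℂ) ^ 3 * (s : ℂ) + 27 * (ν : ℂ) ^ 2 * (s : ℂ) ^ 2)
        ^ (1 / 2 : ℂ)) ^ (1 / 3 : ℂ)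

/-- The three complex roots `ζ₁, ζ₂, ζ₃` (indices `0, 1, 2`) of `s = 2 ζ² (lam + ζ/ν)`, by their
closed formulas. -/
def dualRoot (ν lam s : ℝ) : Fin 3 → ℂ :=
  ![1 / 3 * (-(ν : ℂ) * lam
      + (4 : ℂ) ^ (1 / 3 : ℂ) * (ν : ℂ) ^ 2 * (lam : ℂ) ^ 2 * (dualOmega ν lam s)⁻¹
      + dualOmega ν lam s * (4 : ℂ) ^ (-1 / 3 : ℂ)),
    -(ν : ℂ) * lam / 3
      - 1 / 3 * (2 : ℂ) ^ (-1 / 3 : ℂ) * (1 - Complex.I * (3 : ℂ) ^ (1 / 2 : ℂ))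
        * (ν : ℂ) ^ 2 * (lam : ℂ) ^ 2 * (dualOmega ν lam s)⁻¹
      - 1 / 6 * (4 : ℂ) ^ (-1 / 3 : ℂ) * (1 + Complex.I * (3 : ℂ) ^ (1 / 2 : ℂ))
        * dualOmega ν lam s,
    -(ν : ℂ) * lam / 3
      - 1 / 3 * (2 : ℂ) ^ (-1 / 3 : ℂ) * (1 + Complex.I * (3 : ℂ) ^ (1 / 2 : ℂ))
        * (ν : ℂ) ^ 2 * (lam : ℂ) ^ 2 * (dualOmega ν lam s)⁻¹
      - 1 / 6 * (4 : ℂ) ^ (-1 / 3 : ℂ) * (1 - Complex.I * (3 : ℂ) ^ (1 / 2 : ℂ))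
        * dualOmega ν lam s]

/-- The field `x ↦ ζᵢ(x)` as a real function; it is only used at points where the root is real. -/
def dualField {n : ℕ} (ν lam : ℝ) (σ : Eucl n → Eucl n) (i : Fin 3) (x : Eucl n) : ℝ :=
  (dualRoot ν lam (‖σ x‖ ^ 2) i).re

/-- The field `σ ζᵢ⁻¹`. -/
def strainField {n : ℕ} (ν lam : ℝ) (σ : Eucl n → Eucl n) (i : Fin 3) (x : Eucl n) : Eucl n :=
  (dualField ν lam σ i x)⁻¹ • σ x

/-- The compatibility region: the points `x` of `closure Ω` where `ζᵢ` is real and nonzero, the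
field `F = σ ζᵢ⁻¹` is differentiable (one-sidedly if `x ∈ ∂Ω`), and `∂ⱼ Fₖ - ∂ₖ Fⱼ = 0` for all
`j, k`. -/
def compatRegion {n : ℕ} (Ω : Set (Eucl n)) (ν lam : ℝ) (σ : Eucl n → Eucl n) (i : Fin 3) :
    Set (Eucl n) :=
  {x ∈ closure Ω | (dualRoot ν lam (‖σ x‖ ^ 2) i).im = 0 ∧ dualRoot ν lam (‖σ x‖ ^ 2) i ≠ 0 ∧
    DifferentiableWithinAt ℝ (strainField ν lam σ i) (closure Ω) x ∧
    ∀ j k : Fin n,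
      (fderivWithin ℝ (strainField ν lam σ i) (closure Ω) x (EuclideanSpace.single j 1)) k
        - (fderivWithin ℝ (strainField ν lam σ i) (closure Ω) x (EuclideanSpace.single k 1)) j
        = 0}

/-! ### Path integrals -/

/-- Piecewise `C¹` paths: finite concatenations of `C¹` paths. -/
inductive IsPiecewiseC1 {n : ℕ} : ∀ {a b : Eucl n}, Path a b → Prop
  | smooth {a b : Eucl n} (γ : Path a b) (h : ContDiffOn ℝ 1 γ.extend (Icc 0 1)) :
      IsPiecewiseC1 γ
  | trans {a b c : Eucl n} (γ₁ : Path a b) (γ₂ : Path b c) (h₁ : IsPiecewiseC1 γ₁)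
      (h₂ : IsPiecewiseC1 γ₂) : IsPiecewiseC1 (γ₁.trans γ₂)

/-- On `D`, the function `u` is the path integral `u(x) = ∫_{x₀}^x F · ds + c`, whatever piecewise
`C¹` path in `D` is taken from `x₀` to `x`. -/
def IsPathIntegral {n : ℕ} (D : Set (Eucl n)) (F : Eucl n → Eucl n) (x₀ : Eucl n) (c : ℝ)
    (u : Eucl n → ℝ) : Prop :=
  ∀ (x : Eucl n) (γ : Path x₀ x), IsPiecewiseC1 γ → (∀ s, γ s ∈ D) →
    u x = (∫ᶜ y in γ, innerSL ℝ (F y)) + c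

end

/-!
The three parts of the theorem have independent reasons.

*The roots.* Dividing the radical `ω` by `4^(1/3) ν lam` gives a number `w` for which the roots are
`(ν lam / 3) (z - 1)`, where `z` runs through `w + w⁻¹` and its two analogues with `w` multiplied by a
primitive cube root of unity (`dualRoot_eq_of_dualOmega_eq`). The principal branches place `w` either
on the arc `exp (i θ)`, `0 ≤ θ ≤ π/3`, or on the half-line `(1, ∞)`
(`exists_normalized_dualOmega`). On the arc the roots are values of cosines on explicit intervals; on
the half-line two of them are not real (`dualRoot_location`).

*The potential.* A curl-free differentiable field on a simply connected open set has a primitive: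
local primitives exist on balls by Mathlib's Poincaré lemma, and their additive constants form a
covering space, which has a section (`IsSimplyConnected.exists_forall_hasFDerivAt`). Paths in `D` may
touch `∂Ω` in a complicated set. Since the boundary is `C¹`, they can be translated into `Ω` locally
(`HasC1Boundary.inwardAccessible`), the primitive has boundary values
(`InwardAccessible.exists_boundary_values`), and the fundamental theorem of calculus survives the
limit (`integral_eq_sub_of_boundary_values`). Conversely, any function given by path integrals has
gradient `σ ζᵢ⁻¹` in the interior (`IsPathIntegral.hasGradientAt`).

*The boundary value problem and the energies.* The cubic says exactly that the stress at `σ ζᵢ⁻¹` is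
`σ` (`stress_smul`), so both boundary value problems are the one that `σ` solves. The weak gradient of
an admissible `u` agrees a.e. with the classical one (`IsWeakGradient.ae_eq`), so every energy density
becomes a polynomial in `|∇u|²`, and testing the problem with `u` closes the duality gap
(`integrable_and_no_duality_gap`).
-/

/-! ### The roots of the cubic -/

theorem ofNat_cpow_third_identities :
    (4 : ℂ) ^ (-1 / 3 : ℂ) = ((4 : ℂ) ^ (1 / 3 : ℂ))⁻¹ ∧
      (2 : ℂ) ^ (-1 / 3 : ℂ) = (4 : ℂ) ^ (1 / 3 : ℂ) / 2 := by
  constructor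
  · rw [← Complex.cpow_neg]; norm_num
  · have h4 : (4 : ℂ) ^ (1 / 3 : ℂ) = (2 : ℂ) ^ (2 / 3 : ℂ) := by
      have h : (4 : ℂ) = 2 * 2 := by norm_num
      have := Complex.mul_cpow_ofReal_nonneg (a := 2) (b := 2) (by norm_num) (by norm_num) (1 / 3)
      push_cast at this
      rw [h, this, ← Complex.cpow_add _ _ two_ne_zero]
      norm_num
    rw [h4, eq_div_iff two_ne_zero, show (2 / 3 : ℂ) = -1 / 3 + 1 by norm_num,
      Complex.cpow_add _ _ two_ne_zero, Complex.cpow_one]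

theorem three_cpow_half : (3 : ℂ) ^ (1 / 2 : ℂ) = ((√3 : ℝ) : ℂ) := by
  rw [Real.sqrt_eq_rpow, Complex.ofReal_cpow (by norm_num)]
  norm_num

/-- In terms of the rescaled radical `w = ω / (4^(1/3) ν lam)`, the roots are
`(ν lam / 3) (z - 1)` with `z = w + w⁻¹`, `z = η w + (η w)⁻¹` and `z = η⁻¹ w + (η⁻¹ w)⁻¹`, where
`η = -(1 + i √3) / 2` is a primitive cube root of unity. -/
theorem dualRoot_eq_of_dualOmega_eq {ν lam s : ℝ} (hν : 0 < ν) (hlam : 0 < lam) {w : ℂ}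
    (hw : w ≠ 0) (hω : dualOmega ν lam s = (4 : ℂ) ^ (1 / 3 : ℂ) * (ν * lam) * w) :
    dualRoot ν lam s = ![ν * lam / 3 * (w + w⁻¹ - 1),
      ν * lam / 3 * (-(1 + Complex.I * (√3 : ℝ)) / 2 * w - (1 - Complex.I * (√3 : ℝ)) / 2 * w⁻¹ - 1),
      ν * lam / 3 *
        (-(1 - Complex.I * (√3 : ℝ)) / 2 * w - (1 + Complex.I * (√3 : ℝ)) / 2 * w⁻¹ - 1)] := by
  obtain ⟨h1, h2⟩ := ofNat_cpow_third_identities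
  have hν' : (ν : ℂ) ≠ 0 := by exact_mod_cast hν.ne'
  have hlam' : (lam : ℂ) ≠ 0 := by exact_mod_cast hlam.ne'
  have hc : (4 : ℂ) ^ (1 / 3 : ℂ) ≠ 0 := by simp [Complex.cpow_eq_zero_iff]
  unfold dualRoot
  rw [hω, three_cpow_half, h1, h2]
  congr 1
  · field_simp
    ring
  congr 1
  · field_simp
    ring
  congr 1
  · field_simp
    ring

theorem real_cpow_half_of_nonneg {x : ℝ} (hx : 0 ≤ x) :
    (x : ℂ) ^ (1 / 2 : ℂ) = ((√x : ℝ) : ℂ) := by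
  rw [Real.sqrt_eq_rpow, Complex.ofReal_cpow hx]
  norm_num

theorem real_cpow_half_of_nonpos {x : ℝ} (hx : x ≤ 0) :
    (x : ℂ) ^ (1 / 2 : ℂ) = Complex.I * ((√(-x) : ℝ) : ℂ) := by
  have h : Complex.exp (Real.pi * Complex.I * (1 / 2)) = Complex.I := by
    rw [show (Real.pi : ℂ) * Complex.I * (1 / 2) = Real.pi / 2 * Complex.I by ring,
      Complex.exp_pi_div_two_mul_I]
  rw [Complex.ofReal_cpow_of_nonpos hx, ← Complex.ofReal_neg,
    real_cpow_half_of_nonneg (neg_nonneg.2 hx), h, mul_comm]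

theorem four_cpow_third : (4 : ℂ) ^ (1 / 3 : ℂ) = (((4 : ℝ) ^ (1 / 3 : ℝ) : ℝ) : ℂ) := by
  rw [Complex.ofReal_cpow (by norm_num)]
  norm_num

theorem four_cpow_third_pow : ((4 : ℂ) ^ (1 / 3 : ℂ)) ^ 3 = 4 := by
  rw [← Complex.cpow_nat_mul]
  norm_num

/-- A cube root of the radicand of `ω` is the principal one as soon as its argument lies in
`(-π/3, π/3]`. -/
theorem dualOmega_eq_of_cube_eq {ν lam s : ℝ} (hν : 0 < ν) (hlam : 0 < lam) {w : ℂ}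
    (harg : -(Real.pi / 3) < w.arg) (harg' : w.arg ≤ Real.pi / 3)
    (hw : 4 * ((ν : ℂ) * lam) ^ 3 * w ^ 3 = -4 * (ν : ℂ) ^ 3 * (lam : ℂ) ^ 3 + 27 * (ν : ℂ) * (s : ℂ)
      + 3 * (√3 : ℝ) * ((-8 * ν ^ 4 * lam ^ 3 * s + 27 * ν ^ 2 * s ^ 2 : ℝ) : ℂ) ^ (1 / 2 : ℂ)) :
    dualOmega ν lam s = (4 : ℂ) ^ (1 / 3 : ℂ) * (ν * lam) * w := by
  have hx : ((4 : ℂ) ^ (1 / 3 : ℂ) * (ν * lam) * w).arg = w.arg := by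
    rw [four_cpow_third, ← Complex.ofReal_mul, ← Complex.ofReal_mul]
    exact Complex.arg_real_mul _ (by positivity)
  have h := Complex.pow_cpow_nat_inv (x := (4 : ℂ) ^ (1 / 3 : ℂ) * (ν * lam) * w) (n := 3)
    (by norm_num) (by rw [hx]; exact_mod_cast harg) (by rw [hx]; exact_mod_cast harg')
  rw [← h, mul_pow, mul_pow, four_cpow_third_pow, hw]
  unfold dualOmega
  rw [three_cpow_half]
  push_cast
  norm_num

/-- Below the threshold the inner square root is imaginary, the radicand of `ω` lies on the circle of
radius `4 (ν lam)³`, in the closed upper half-plane, and the rescaled radical is `exp (i θ)` with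
`θ ∈ [0, π/3]`. -/
theorem exists_dualOmega_eq_exp {ν lam s : ℝ} (hν : 0 < ν) (hlam : 0 < lam) (hs : 0 ≤ s)
    (h : s ≤ 8 * lam ^ 3 * ν ^ 2 / 27) :
    ∃ θ : ℝ, 0 ≤ θ ∧ θ ≤ Real.pi / 3 ∧
      dualOmega ν lam s = (4 : ℂ) ^ (1 / 3 : ℂ) * (ν * lam) * Complex.exp (θ * Complex.I) ∧
      4 * (ν * lam) ^ 3 * Real.cos (3 * θ) = -4 * (ν * lam) ^ 3 + 27 * ν * s := by
  have ha : 0 < 4 * (ν * lam) ^ 3 := by positivity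
  set k : ℝ := (-4 * (ν * lam) ^ 3 + 27 * ν * s) / (4 * (ν * lam) ^ 3) with hk
  have hk1 : -1 ≤ k := by
    rw [hk, le_div_iff₀ ha]
    nlinarith [mul_nonneg hν.le hs]
  have hk2 : k ≤ 1 := by
    rw [hk, div_le_iff₀ ha]
    nlinarith [mul_le_mul_of_nonneg_left h hν.le]
  have hθ0 := Real.arccos_nonneg k
  have hθ1 := Real.arccos_le_pi k
  have hπ := Real.pi_pos
  have hcos : Real.cos (3 * (Real.arccos k / 3)) = k := by
    rw [mul_div_cancel₀ _ three_ne_zero, Real.cos_arccos hk1 hk2]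
  have hkmul : 4 * (ν * lam) ^ 3 * k = -4 * (ν * lam) ^ 3 + 27 * ν * s := by
    rw [hk]; field_simp
  refine ⟨Real.arccos k / 3, by positivity, by linarith, ?_, by rw [hcos, hkmul]⟩
  have hlt : (Real.arccos k / 3) ∈ Ioc (-Real.pi) Real.pi := ⟨by linarith, by linarith⟩
  apply dualOmega_eq_of_cube_eq hν hlam
  · rw [Complex.arg_exp_mul_I, toIocMod_eq_self _ |>.2 ⟨hlt.1, by linarith⟩]
    linarith
  · rw [Complex.arg_exp_mul_I, toIocMod_eq_self _ |>.2 ⟨hlt.1, by linarith⟩]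
    linarith
  have hsin : Real.sin (Real.arccos k) = √(1 - k ^ 2) := Real.sin_arccos k
  have hw : Complex.exp ((Real.arccos k / 3 : ℝ) * Complex.I) ^ 3
      = k + √(1 - k ^ 2) * Complex.I := by
    rw [← Complex.exp_nat_mul, ← hsin]
    have : ((3 : ℕ) : ℂ) * ((Real.arccos k / 3 : ℝ) * Complex.I) = Real.arccos k * Complex.I := by
      push_cast; ring
    rw [this, Complex.exp_mul_I, ← Complex.ofReal_cos, ← Complex.ofReal_sin,
      Real.cos_arccos hk1 hk2]
  -- With `4 (ν lam)³ k` the real part of the radicand, the inner radicand is a multiple of `k² - 1`.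
  have hE : -8 * ν ^ 4 * lam ^ 3 * s + 27 * ν ^ 2 * s ^ 2
      = -((4 * (ν * lam) ^ 3) ^ 2 * (1 - k ^ 2) / 27) := by
    have : (4 * (ν * lam) ^ 3) ^ 2 * (1 - k ^ 2)
        = (4 * (ν * lam) ^ 3) ^ 2 - (4 * (ν * lam) ^ 3 * k) ^ 2 := by ring
    rw [this, hkmul]
    ring
  have hk' : 0 ≤ 1 - k ^ 2 := by nlinarith
  have hroot : 3 * √3 * √((4 * (ν * lam) ^ 3) ^ 2 * (1 - k ^ 2) / 27)
      = 4 * (ν * lam) ^ 3 * √(1 - k ^ 2) := by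
    rw [Real.sqrt_div' _ (by norm_num), Real.sqrt_mul (by positivity), Real.sqrt_sq ha.le,
      show (27 : ℝ) = 3 ^ 2 * 3 by norm_num, Real.sqrt_mul (by positivity),
      Real.sqrt_sq (by norm_num)]
    field_simp
  rw [hw, hE, real_cpow_half_of_nonpos (neg_nonpos.2 (by positivity)), neg_neg]
  have hroot' := congrArg (fun x : ℝ => (x : ℂ)) hroot
  have hkmul' := congrArg (fun x : ℝ => (x : ℂ)) hkmul
  push_cast at hroot' hkmul' ⊢
  linear_combination hkmul' - Complex.I * hroot'

/-- Above the threshold the radicand of `ω` is real and exceeds `4 (ν lam)³`, so the rescaled radical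
is a real number greater than `1`. -/
theorem exists_dualOmega_eq_ofReal {ν lam s : ℝ} (hν : 0 < ν) (hlam : 0 < lam)
    (h : 8 * lam ^ 3 * ν ^ 2 / 27 < s) :
    ∃ w : ℝ, 1 < w ∧ dualOmega ν lam s = (4 : ℂ) ^ (1 / 3 : ℂ) * (ν * lam) * w ∧
      2 * (ν * lam) ^ 3 * (w ^ 3 + (w ^ 3)⁻¹) = -4 * (ν * lam) ^ 3 + 27 * ν * s := by
  have ha : 0 < 4 * (ν * lam) ^ 3 := by positivity
  set k : ℝ := (-4 * (ν * lam) ^ 3 + 27 * ν * s) / (4 * (ν * lam) ^ 3) with hk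
  have hk1 : 1 < k := by
    rw [hk, lt_div_iff₀ ha]
    nlinarith [mul_lt_mul_of_pos_left h hν]
  have hkmul : 4 * (ν * lam) ^ 3 * k = -4 * (ν * lam) ^ 3 + 27 * ν * s := by
    rw [hk]; field_simp
  have hk' : 0 ≤ k ^ 2 - 1 := by nlinarith
  set r : ℝ := √(k ^ 2 - 1) with hr
  have hr0 : 0 ≤ r := Real.sqrt_nonneg _
  have hr2 : r ^ 2 = k ^ 2 - 1 := Real.sq_sqrt hk'
  have hw3 : ((k + r) ^ (1 / 3 : ℝ)) ^ 3 = k + r := by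
    rw [← Real.rpow_natCast, ← Real.rpow_mul (by linarith)]
    norm_num
  have hw1 : 1 < (k + r) ^ (1 / 3 : ℝ) := Real.one_lt_rpow (by linarith) (by norm_num)
  have hπ := Real.pi_pos
  have hinv : (k + r)⁻¹ = k - r := by
    apply inv_eq_of_mul_eq_one_right
    linear_combination -hr2
  refine ⟨(k + r) ^ (1 / 3 : ℝ), hw1, ?_, ?_⟩
  · apply dualOmega_eq_of_cube_eq hν hlam
    · rw [Complex.arg_ofReal_of_nonneg (by positivity)]; linarith
    · rw [Complex.arg_ofReal_of_nonneg (by positivity)]; linarith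
    have hE : -8 * ν ^ 4 * lam ^ 3 * s + 27 * ν ^ 2 * s ^ 2
        = (4 * (ν * lam) ^ 3) ^ 2 * (k ^ 2 - 1) / 27 := by
      have : (4 * (ν * lam) ^ 3) ^ 2 * (k ^ 2 - 1)
          = (4 * (ν * lam) ^ 3 * k) ^ 2 - (4 * (ν * lam) ^ 3) ^ 2 := by ring
      rw [this, hkmul]
      ring
    have hroot : 3 * √3 * √((4 * (ν * lam) ^ 3) ^ 2 * (k ^ 2 - 1) / 27)
        = 4 * (ν * lam) ^ 3 * r := by
      rw [Real.sqrt_div' _ (by norm_num), Real.sqrt_mul (by positivity), Real.sqrt_sq ha.le,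
        show (27 : ℝ) = 3 ^ 2 * 3 by norm_num, Real.sqrt_mul (by positivity),
        Real.sqrt_sq (by norm_num)]
      field_simp
      rw [hr]
    rw [hE, real_cpow_half_of_nonneg (by positivity), ← Complex.ofReal_pow, hw3]
    have hroot' := congrArg (fun x : ℝ => (x : ℂ)) hroot
    have hkmul' := congrArg (fun x : ℝ => (x : ℂ)) hkmul
    push_cast at hroot' hkmul' ⊢
    linear_combination hkmul' - hroot'
  · rw [hw3, hinv]
    linear_combination hkmul

/-- The rescaled radical `w`: `w³ + w⁻³` is the right side of the depressed cubic `z³ - 3 z = c`; and `w`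
is either `exp (i θ)` with `θ ∈ [0, π/3]` or a real number greater than `1`, according to the sign of
the discriminant. -/
theorem exists_normalized_dualOmega {ν lam s : ℝ} (hν : 0 < ν) (hlam : 0 < lam) (hs : 0 ≤ s) :
    ∃ w : ℂ, w ≠ 0 ∧ dualOmega ν lam s = (4 : ℂ) ^ (1 / 3 : ℂ) * (ν * lam) * w ∧
      2 * ((ν : ℂ) * lam) ^ 3 * (w ^ 3 + (w⁻¹) ^ 3) = -4 * ((ν : ℂ) * lam) ^ 3 + 27 * ν * s ∧
      ((s ≤ 8 * lam ^ 3 * ν ^ 2 / 27 ∧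
          ∃ θ : ℝ, 0 ≤ θ ∧ θ ≤ Real.pi / 3 ∧ w = Complex.exp (θ * Complex.I)) ∨
        (8 * lam ^ 3 * ν ^ 2 / 27 < s ∧ ∃ r : ℝ, 1 < r ∧ w = r)) := by
  rcases le_or_gt s (8 * lam ^ 3 * ν ^ 2 / 27) with h | h
  · obtain ⟨θ, h0, h1, hω, hcos⟩ := exists_dualOmega_eq_exp hν hlam hs h
    refine ⟨_, Complex.exp_ne_zero _, hω, ?_, Or.inl ⟨h, θ, h0, h1, rfl⟩⟩
    rw [← Complex.exp_neg, ← Complex.exp_nat_mul, ← Complex.exp_nat_mul]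
    have hcos' := congrArg (fun x : ℝ => (x : ℂ)) hcos
    push_cast [Complex.cos] at hcos' ⊢
    rw [← hcos']
    ring_nf
  · obtain ⟨r, h1, hω, hr⟩ := exists_dualOmega_eq_ofReal hν hlam h
    refine ⟨r, by exact_mod_cast (by linarith : r ≠ 0), hω, ?_, Or.inr ⟨h, r, h1, rfl⟩⟩
    have hr' := congrArg (fun x : ℝ => (x : ℂ)) hr
    push_cast at hr' ⊢
    rw [← hr', inv_pow]

theorem I_mul_sqrt_three_sq : (Complex.I * (√3 : ℝ)) ^ 2 = -3 := by
  have h : ((√3 : ℝ) : ℂ) ^ 2 = 3 := by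
    rw [← Complex.ofReal_pow, Real.sq_sqrt (by norm_num)]
    norm_num
  rw [mul_pow, Complex.I_sq, h]
  norm_num

/-- The three closed formulas give all the roots: the substitution `ζ = (ν lam / 3) (z - 1)` turns the
cubic into `z³ - 3 z = w³ + w⁻³`, whose left side minus right side factors over the three values of
`z` found by Cardano's formula. -/
theorem cubic_iff_dualRoot {ν lam s : ℝ} (hν : 0 < ν) (hlam : 0 < lam) (hs : 0 ≤ s) (ζ : ℂ) :
    (s : ℂ) = 2 * ζ ^ 2 * (lam + ζ / ν) ↔ ∃ i, ζ = dualRoot ν lam s i := by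
  obtain ⟨w, hw0, hω, hw, -⟩ := exists_normalized_dualOmega hν hlam hs
  have hν' : (ν : ℂ) ≠ 0 := by exact_mod_cast hν.ne'
  have h3 := I_mul_sqrt_three_sq
  have hfac : 2 * ζ ^ 2 * (lam * ν + ζ) - ν * s =
      2 * ((ζ - dualRoot ν lam s 0) * (ζ - dualRoot ν lam s 1) * (ζ - dualRoot ν lam s 2)) := by
    rw [dualRoot_eq_of_dualOmega_eq hν hlam hw0 hω]
    simp only [Matrix.cons_val]
    have hww : w * w⁻¹ = 1 := mul_inv_cancel₀ hw0
    generalize w⁻¹ = v at *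
    generalize Complex.I * (√3 : ℝ) = r at *
    set a : ℂ := ν * lam with ha
    have hαβ : (-(1 + r) / 2 * w - (1 - r) / 2 * v) * (-(1 - r) / 2 * w - (1 + r) / 2 * v) =
        w ^ 2 + v ^ 2 - 1 := by
      linear_combination (w * v / 2 - (w ^ 2 + v ^ 2) / 4) * h3 - hww
    linear_combination -(2 * (ζ - a / 3 * (w + v - 1)) * (a / 3) ^ 2) * hαβ + (1 / 27) * hw
      + 2 * (a / 3) ^ 2 * (2 * ζ + a * (2 + w + v) / 3) * hww
  have hiff : (s : ℂ) = 2 * ζ ^ 2 * (lam + ζ / ν) ↔ 2 * ζ ^ 2 * (lam * ν + ζ) - ν * s = 0 := by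
    rw [sub_eq_zero, ← mul_right_inj' hν', eq_comm]
    field_simp
  rw [hiff, hfac, Fin.exists_fin_succ, Fin.exists_fin_two]
  simp [sub_eq_zero, or_assoc]

theorem encard_real_cubic_le_three {ν lam s : ℝ} (hν : 0 < ν) (hlam : 0 < lam) (hs : 0 ≤ s) :
    {ζ : ℝ | s = 2 * ζ ^ 2 * (lam + ζ / ν)}.encard ≤ 3 := by
  have hsub : (fun x : ℝ => (x : ℂ)) '' {ζ : ℝ | s = 2 * ζ ^ 2 * (lam + ζ / ν)} ⊆
      range (dualRoot ν lam s) := by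
    rintro _ ⟨ζ, hζ, rfl⟩
    have := (cubic_iff_dualRoot hν hlam hs ζ).1 (by exact_mod_cast hζ)
    obtain ⟨i, hi⟩ := this
    exact ⟨i, hi.symm⟩
  rw [← Complex.ofReal_injective.encard_image]
  refine (encard_le_encard hsub).trans ?_
  rw [← image_univ]
  refine (encard_image_le _ _).trans ?_
  simp

/-- For `w = exp (i θ)` the roots are real, namely `(ν lam / 3) (2 cos θ - 1)` and
`-(ν lam / 3) (1 + 2 cos (θ ± π/3))`; for real `w > 1` the last two are not real. -/
theorem dualRoot_location {ν lam s : ℝ} (hν : 0 < ν) (hlam : 0 < lam) (hs : 0 ≤ s) :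
    ((dualRoot ν lam s 0).im = 0 ∧ 0 ≤ (dualRoot ν lam s 0).re) ∧
      ((dualRoot ν lam s 1).im = 0 →
        (dualRoot ν lam s 1).re ≤ 0 ∧ -(2 * ν * lam / 3) ≤ (dualRoot ν lam s 1).re) ∧
      ((dualRoot ν lam s 2).im = 0 →
        (dualRoot ν lam s 2).re ≤ -(2 * ν * lam / 3) ∧ -(ν * lam) ≤ (dualRoot ν lam s 2).re) ∧
      (s ≤ 8 * lam ^ 3 * ν ^ 2 / 27 →
        (dualRoot ν lam s 1).im = 0 ∧ (dualRoot ν lam s 2).im = 0) := by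
  obtain ⟨w, hw0, hω, -, hw⟩ := exists_normalized_dualOmega hν hlam hs
  rw [dualRoot_eq_of_dualOmega_eq hν hlam hw0 hω]
  have ha : 0 < ν * lam := mul_pos hν hlam
  simp only [Matrix.cons_val]
  rcases hw with ⟨hle, θ, h0, h1, rfl⟩ | ⟨hlt, r, hr, rfl⟩
  · have e1 : (ν : ℂ) * lam / 3 * (Complex.exp (θ * Complex.I) + (Complex.exp (θ * Complex.I))⁻¹ - 1)
        = ((ν * lam / 3 * (2 * Real.cos θ - 1) : ℝ) : ℂ) := by
      rw [← Complex.exp_neg]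
      push_cast [Complex.cos]
      ring_nf
    -- The sign `ε = ±1` treats the second and third root together.
    have aux : ∀ ε φ : ℝ, Real.cos φ = 1 / 2 → Real.sin φ = ε * (√3 / 2) →
        (ν : ℂ) * lam / 3 * (-(1 + ε * (Complex.I * (√3 : ℝ))) / 2 * Complex.exp (θ * Complex.I)
          - (1 - ε * (Complex.I * (√3 : ℝ))) / 2 * (Complex.exp (θ * Complex.I))⁻¹ - 1)
        = ((ν * lam / 3 * (-2 * Real.cos (θ + φ) - 1) : ℝ) : ℂ) := by
      intro ε φ hc hsn
      rw [← Complex.exp_neg, ← neg_mul, Complex.exp_mul_I, Complex.exp_mul_I, Complex.cos_neg,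
        Complex.sin_neg, Real.cos_add, hc, hsn]
      push_cast
      linear_combination (ν : ℂ) * lam / 3 * (ε * (√3 : ℝ) * Complex.sin θ) *
        (-Complex.I_sq)
    have e2 := aux 1 (Real.pi / 3) Real.cos_pi_div_three (by rw [Real.sin_pi_div_three]; ring)
    have e3 := aux (-1) (-(Real.pi / 3)) (by rw [Real.cos_neg, Real.cos_pi_div_three])
      (by rw [Real.sin_neg, Real.sin_pi_div_three]; ring)
    simp only [Complex.ofReal_neg, Complex.ofReal_one, one_mul, neg_mul, sub_neg_eq_add,
      ← sub_eq_add_neg (1 : ℂ)] at e2 e3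
    simp only [← sub_eq_add_neg] at e3
    rw [e1, e2, e3]
    simp only [Complex.ofReal_re, Complex.ofReal_im, true_and, implies_true, and_true,
      forall_const]
    have hπ := Real.pi_pos
    have c1 : 1 / 2 ≤ Real.cos θ := by
      rw [← Real.cos_pi_div_three]
      exact Real.cos_le_cos_of_nonneg_of_le_pi h0 (by linarith) h1
    have c2 : Real.cos (θ + Real.pi / 3) ≤ 1 / 2 := by
      rw [← Real.cos_pi_div_three]
      exact Real.cos_le_cos_of_nonneg_of_le_pi (by linarith) (by linarith) (by linarith)
    have c3 : -(1 / 2) ≤ Real.cos (θ + Real.pi / 3) := by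
      rw [← Real.cos_pi_div_three, ← Real.cos_pi_sub]
      exact Real.cos_le_cos_of_nonneg_of_le_pi (by linarith) (by linarith) (by linarith)
    have c4 : 1 / 2 ≤ Real.cos (θ - Real.pi / 3) := by
      rw [← Real.cos_pi_div_three, ← Real.cos_abs (θ - _)]
      refine Real.cos_le_cos_of_nonneg_of_le_pi (abs_nonneg _) (by linarith) ?_
      rw [abs_le]; constructor <;> linarith
    have c5 := Real.cos_le_one (θ - Real.pi / 3)
    refine ⟨by nlinarith, ⟨by nlinarith, by nlinarith⟩, by nlinarith, by nlinarith⟩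
  · have hr1 : r⁻¹ < 1 := inv_lt_one_of_one_lt₀ hr
    have hpos : 0 < ν * lam / 3 * (√3 / 2 * (r - r⁻¹)) := by
      have : 0 < r - r⁻¹ := by linarith
      positivity
    have hadd : 1 ≤ r + r⁻¹ := by
      have : 0 < r⁻¹ := by positivity
      linarith
    have i1 : ((ν : ℂ) * lam / 3 * (r + (r : ℂ)⁻¹ - 1)) = ((ν * lam / 3 * (r + r⁻¹ - 1) : ℝ) : ℂ) := by
      push_cast; rfl
    have i2 : ((ν : ℂ) * lam / 3 * (-(1 + Complex.I * (√3 : ℝ)) / 2 * r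
        - (1 - Complex.I * (√3 : ℝ)) / 2 * (r : ℂ)⁻¹ - 1))
        = ((ν * lam / 3 * (-(r + r⁻¹) / 2 - 1) : ℝ) : ℂ)
          + ((-(ν * lam / 3 * (√3 / 2 * (r - r⁻¹))) : ℝ) : ℂ) * Complex.I := by
      push_cast; ring
    have i3 : ((ν : ℂ) * lam / 3 * (-(1 - Complex.I * (√3 : ℝ)) / 2 * r
        - (1 + Complex.I * (√3 : ℝ)) / 2 * (r : ℂ)⁻¹ - 1))
        = ((ν * lam / 3 * (-(r + r⁻¹) / 2 - 1) : ℝ) : ℂ)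
          + ((ν * lam / 3 * (√3 / 2 * (r - r⁻¹)) : ℝ) : ℂ) * Complex.I := by
      push_cast; ring
    rw [i1, i2, i3]
    simp only [Complex.add_im, Complex.ofReal_im, Complex.im_ofReal_mul,
      Complex.I_im, mul_one, zero_add, Complex.ofReal_re, true_and]
    refine ⟨by nlinarith, fun h => by linarith, fun h => by linarith, fun h => by linarith⟩

/-! ### Primitives of closed forms and inward directions -/

/-- On a simply connected, locally path connected space, local functions `P a` on open sets `B a`
whose differences are locally constant are, up to constants, restrictions of a global function. The
additive constants form a covering space, which has a global section. -/
theorem exists_sub_eq_of_locally_constant_sub {A G : Type*} [TopologicalSpace A]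
    [SimplyConnectedSpace A] [LocallyPathConnectedSpace A] [AddCommGroup G]
    (B : A → Set A) (hB : ∀ a, IsOpen (B a)) (hmem : ∀ a, a ∈ B a) (P : A → A → G)
    (hP : ∀ i j, ∀ x ∈ B i ∩ B j, ∀ᶠ y in 𝓝 x, P i y - P j y = P i x - P j x) :
    ∃ g : A → G, ∀ x, ∀ᶠ y in 𝓝 x, g y - g x = P x y - P x x := by
  -- A point of the fibre over `x`, read in the chart `i`, is the constant that has to be added to
  -- `P i`. The fibre is discrete, so the bundle is a covering.
  let _ : TopologicalSpace G := ⊥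
  have : DiscreteTopology G := ⟨rfl⟩
  let Z : FiberBundleCore A A G :=
    { baseSet := B
      isOpen_baseSet := hB
      indexAt := id
      mem_baseSet_at := hmem
      coordChange := fun i j x v => v + (P i x - P j x)
      coordChange_self := by simp
      continuousOn_coordChange := by
        rintro i j ⟨x, v⟩ ⟨hx, -⟩
        have h1 : ContinuousAt (fun y => P i y - P j y) x :=
          (continuousAt_const (y := P i x - P j x)).congr ((hP i j x hx).mono fun y hy => hy.symm)
        exact (continuousAt_snd.add
          (ContinuousAt.comp (f := Prod.fst) (x := (x, v)) h1 continuousAt_fst)).continuousWithinAt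
      coordChange_comp := by
        intro i j k x _ v
        abel }
  obtain ⟨a₀⟩ : Nonempty A := inferInstance
  obtain ⟨s, ⟨-, hs⟩, -⟩ :=
    (FiberBundle.isCoveringMap (F := G) (E := Z.Fiber)).existsUnique_continuousMap_lifts
      (ContinuousMap.id A) a₀ ⟨a₀, (0 : G)⟩ rfl
  have hs' : ∀ y, (s y).1 = y := fun y => congrFun hs y
  refine ⟨fun y => (show G from (s y).2) + P y y, fun x => ?_⟩
  have hx : s x ∈ (Z.localTriv x).source := by
    rw [Z.mem_localTriv_source, hs']
    exact hmem x
  have hc : ContinuousAt (fun y => ((Z.localTriv x) (s y)).2) x :=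
    continuousAt_snd.comp (((Z.localTriv x).continuousAt hx).comp s.continuous.continuousAt)
  have hev := (hc.eventually_mem (isOpen_discrete {((Z.localTriv x) (s x)).2} |>.mem_nhds rfl))
  filter_upwards [hev] with y hy
  rw [mem_singleton_iff, Z.localTriv_apply, Z.localTriv_apply] at hy
  change (show G from (s y).2) + (P (s y).1 (s y).1 - P x (s y).1)
    = (show G from (s x).2) + (P (s x).1 (s x).1 - P x (s x).1) at hy
  rw [hs', hs'] at hy
  rw [sub_self, add_zero] at hy
  rw [← hy]
  abel

/-- A closed differentiable `1`-form on a simply connected open set is exact. The derivative of the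
form need not be continuous. -/
theorem IsSimplyConnected.exists_forall_hasFDerivAt {E : Type*} [NormedAddCommGroup E]
    [NormedSpace ℝ E] {U : Set E} (hU : IsSimplyConnected U) (hUo : IsOpen U)
    {η : E → E →L[ℝ] ℝ} (hη : DifferentiableOn ℝ η U)
    (hsymm : ∀ a ∈ U, ∀ x y, fderiv ℝ η a x y = fderiv ℝ η a y x) :
    ∃ f : E → ℝ, ∀ a ∈ U, HasFDerivAt f (η a) a := by
  have := hU.simplyConnectedSpace
  have := hUo.locallyPathConnectedSpace
  have hball : ∀ a : U, ∃ r > 0, Metric.ball (a : E) r ⊆ U :=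
    fun a => Metric.isOpen_iff.1 hUo a a.2
  choose r hr hrU using hball
  have hprim : ∀ a : U, ∃ f : E → ℝ, ∀ x ∈ Metric.ball (a : E) (r a), HasFDerivAt f (η x) x :=
    fun a => (convex_ball (a : E) (r a)).exists_forall_hasFDerivAt_of_fderiv_symmetric
      Metric.isOpen_ball (hη.mono (hrU a)) fun x hx => hsymm x (hrU a hx)
  choose P hP using hprim
  have hnhds : ∀ a : U, ∀ x ∈ Metric.ball (a : E) (r a),
      Metric.ball (a : E) (r a) ∈ 𝓝 x := fun a x hx => Metric.isOpen_ball.mem_nhds hx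
  obtain ⟨g, hg⟩ := exists_sub_eq_of_locally_constant_sub
    (fun a : U => Subtype.val ⁻¹' Metric.ball (a : E) (r a))
    (fun a => Metric.isOpen_ball.preimage continuous_subtype_val)
    (fun a => Metric.mem_ball_self (hr a)) (fun a x => P a x) (by
      rintro i j x ⟨hxi, hxj⟩
      have hmem : Metric.ball (i : E) (r i) ∩ Metric.ball (j : E) (r j) ∈ 𝓝 (x : E) :=
        inter_mem (hnhds i x hxi) (hnhds j x hxj)
      filter_upwards [continuous_subtype_val.continuousAt.preimage_mem_nhds hmem] with y hy
      have hd : ∀ z ∈ Metric.ball (i : E) (r i) ∩ Metric.ball (j : E) (r j),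
          HasFDerivAt (fun z => P i z - P j z) (0 : E →L[ℝ] ℝ) z := fun z hz => by
        have := (hP i z hz.1).sub (hP j z hz.2)
        rwa [sub_self] at this
      refine (Metric.isOpen_ball.inter Metric.isOpen_ball).is_const_of_fderiv_eq_zero (𝕜 := ℝ)
        ((convex_ball _ _).inter (convex_ball _ _)).isPreconnected
        (fun z hz => (hd z hz).differentiableAt.differentiableWithinAt)
        (fun z hz => (hd z hz).fderiv) hy ⟨hxi, hxj⟩)
  classical
  refine ⟨fun x => if hx : x ∈ U then g ⟨x, hx⟩ else 0, fun a ha => ?_⟩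
  have h1 := hg ⟨a, ha⟩
  rw [nhds_subtype_eq_comap, eventually_comap] at h1
  refine ((hP ⟨a, ha⟩ a (Metric.mem_ball_self (hr _))).add_const
    (g ⟨a, ha⟩ - P ⟨a, ha⟩ a)).congr_of_eventuallyEq ?_
  filter_upwards [h1, hUo.mem_nhds ha] with y hy hyU
  have := hy ⟨y, hyU⟩ rfl
  simp only [dif_pos hyU]
  linarith

/-- The vector `v` points from `D` into `U` near `x`: short translates by `v` of the points of `D` at
distance less than `r` from `x` lie in `U`. -/
def IsInward {E : Type*} [NormedAddCommGroup E] [NormedSpace ℝ E] (U D : Set E) (x v : E)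
    (r : ℝ) : Prop :=
  0 < r ∧ ∀ y ∈ D ∩ Metric.ball x r, ∀ ε ∈ Ioo 0 r, y + ε • v ∈ U

/-- Near each of its points, `D` can be translated into `U` by arbitrarily short vectors. -/
def InwardAccessible {E : Type*} [NormedAddCommGroup E] [NormedSpace ℝ E] (U D : Set E) : Prop :=
  ∀ x ∈ D, ∃ v : E, ∃ r : ℝ, IsInward U D x v r

/-- A vector along which the defining function of the boundary decreases points into the domain, at
all boundary points nearby. -/
theorem HasC1Boundary.inwardAccessible {n : ℕ} {Ω O : Set (Eucl n)} (hΩ : IsOpen Ω)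
    (h : HasC1Boundary Ω) (hO : IsOpen O) : InwardAccessible (Ω ∩ O) (closure Ω ∩ O) := by
  rintro x ⟨hxΩ, hxO⟩
  by_cases hx : x ∈ Ω
  -- At an interior point the zero vector does.
  · obtain ⟨r, hr, hrU⟩ := Metric.isOpen_iff.1 (hΩ.inter hO) x ⟨hx, hxO⟩
    exact ⟨0, r, hr, fun y hy ε _ => by simpa using hrU hy.2⟩
  obtain ⟨V, hV, hxV, ρ, hρ, hρ', hΩV⟩ := h x ⟨hxΩ, by rwa [hΩ.interior_eq]⟩
  have hle : ∀ y ∈ closure Ω ∩ V, ρ y ≤ 0 := by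
    rintro y ⟨hy, hyV⟩
    have hy' : y ∈ closure (Ω ∩ V) := hV.closure_inter ⟨hy, hyV⟩
    have hcont : ContinuousWithinAt ρ (Ω ∩ V) y :=
      (hρ.continuousOn y hyV).mono inter_subset_right
    refine hcont.closure_le hy' continuousWithinAt_const fun z hz => ?_
    rw [hΩV] at hz
    exact hz.2.le
  obtain ⟨v, hv⟩ : ∃ v, fderiv ℝ ρ x v < 0 := by
    by_contra! hcon
    refine hρ' x hxV (ContinuousLinearMap.ext fun v => le_antisymm ?_ (hcon v))
    simpa using hcon (-v)
  have hfc : ContinuousOn (fun z => fderiv ℝ ρ z v) V :=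
    (hρ.continuousOn_fderiv_of_isOpen hV le_rfl).clm_apply continuousOn_const
  have hev : ∀ᶠ z in 𝓝 x, z ∈ V ∧ z ∈ O ∧ fderiv ℝ ρ z v < 0 := by
    filter_upwards [hV.mem_nhds hxV, hO.mem_nhds hxO,
      (hfc.continuousAt (hV.mem_nhds hxV)).eventually_lt continuousAt_const hv] with z h1 h2 h3
    exact ⟨h1, h2, h3⟩
  obtain ⟨R, hR, hball⟩ := Metric.eventually_nhds_iff_ball.1 hev
  refine ⟨v, R / (1 + ‖v‖), by positivity, ?_⟩
  rintro y ⟨⟨hyΩ, -⟩, hyx⟩ ε ⟨hε0, hεr⟩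
  have hvpos : 0 < 1 + ‖v‖ := by positivity
  have hseg : ∀ τ ∈ Icc (0 : ℝ) ε, y + τ • v ∈ Metric.ball x R := by
    intro τ hτ
    rw [Metric.mem_ball] at hyx ⊢
    have h1 : dist (y + τ • v) x ≤ dist y x + τ * ‖v‖ := by
      rw [dist_eq_norm, dist_eq_norm, add_sub_right_comm]
      refine (norm_add_le _ _).trans ?_
      rw [norm_smul, Real.norm_of_nonneg hτ.1]
    have h2 : τ * ‖v‖ ≤ R / (1 + ‖v‖) * ‖v‖ :=
      mul_le_mul_of_nonneg_right (hτ.2.trans hεr.le) (norm_nonneg _)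
    calc dist (y + τ • v) x ≤ dist y x + τ * ‖v‖ := h1
      _ < R / (1 + ‖v‖) + R / (1 + ‖v‖) * ‖v‖ := add_lt_add_of_lt_of_le hyx h2
      _ = R := by field_simp
  have hderiv : ∀ τ ∈ Icc (0 : ℝ) ε,
      HasDerivAt (fun τ : ℝ => ρ (y + τ • v)) (fderiv ℝ ρ (y + τ • v) v) τ := by
    intro τ hτ
    have hV' := (hball _ (hseg τ hτ)).1
    have h1 : HasFDerivAt ρ (fderiv ℝ ρ (y + τ • v)) (y + τ • v) :=
      ((hρ.differentiableOn one_ne_zero).differentiableAt (hV.mem_nhds hV')).hasFDerivAt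
    have h2 : HasDerivAt (fun τ : ℝ => y + τ • v) v τ := by
      simpa using ((hasDerivAt_id τ).smul_const v).const_add y
    exact h1.comp_hasDerivAt τ h2
  have hanti : StrictAntiOn (fun τ : ℝ => ρ (y + τ • v)) (Icc 0 ε) := by
    refine strictAntiOn_of_deriv_neg (convex_Icc 0 ε)
      (fun τ hτ => (hderiv τ hτ).continuousAt.continuousWithinAt) fun τ hτ => ?_
    have hτ' := interior_subset hτ
    rw [(hderiv τ hτ').deriv]
    exact (hball _ (hseg τ hτ')).2.2
  have h0 := hseg 0 (left_mem_Icc.2 hε0.le)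
  have hlt := hanti (left_mem_Icc.2 hε0.le) (right_mem_Icc.2 hε0.le) hε0
  simp only [zero_smul, add_zero] at hlt h0
  have hmem := hball _ (hseg ε (right_mem_Icc.2 hε0.le))
  have : y + ε • v ∈ Ω ∩ V := by
    rw [hΩV]
    exact ⟨hmem.1, hlt.trans_le (hle y ⟨hyΩ, (hball _ h0).1⟩)⟩
  exact ⟨this.1, hmem.2.1⟩

/-! ### Boundary values of primitives -/

section BoundaryValues

variable {E : Type*} [NormedAddCommGroup E] [NormedSpace ℝ E] {U D : Set E}
  {η : E → E →L[ℝ] ℝ} {f g : E → ℝ}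

theorem IsInward.of_mem_ball {x y v : E} {r : ℝ} (h : IsInward U D x v r)
    (hy : y ∈ Metric.ball x r) : IsInward U D y v (r - dist y x) := by
  refine ⟨sub_pos.2 hy, fun z hz ε hε => h.2 z ⟨hz.1, ?_⟩ ε ⟨hε.1, ?_⟩⟩
  · have := hz.2
    rw [Metric.mem_ball] at this ⊢
    linarith [dist_triangle z y x]
  · linarith [hε.2, dist_nonneg (x := y) (y := x)]

theorem ContinuousOn.exists_norm_le_ball (hη : ContinuousOn η D) {x : E} (hx : x ∈ D) :
    ∃ M R : ℝ, 0 ≤ M ∧ 0 < R ∧ ∀ y ∈ D ∩ Metric.ball x R, ‖η y‖ ≤ M := by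
  have h : ∀ᶠ y in 𝓝[D] x, ‖η y‖ < ‖η x‖ + 1 :=
    (hη x hx).norm.eventually_lt continuousWithinAt_const (lt_add_one _)
  obtain ⟨R, hR, hsub⟩ := Metric.mem_nhdsWithin_iff.1 h
  exact ⟨‖η x‖ + 1, R, by positivity, hR, fun y hy => (hsub ⟨hy.2, hy.1⟩).le⟩

theorem abs_sub_le_of_segment_subset (hf : ∀ x ∈ U, HasFDerivAt f (η x) x) {a b : E} {M : ℝ}
    (hU : segment ℝ a b ⊆ U) (hM : ∀ z ∈ segment ℝ a b, ‖η z‖ ≤ M) :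
    |f b - f a| ≤ M * ‖b - a‖ :=
  (convex_segment a b).norm_image_sub_le_of_norm_hasFDerivWithin_le (𝕜 := ℝ)
    (fun x hx => (hf x (hU hx)).hasFDerivWithinAt) hM (left_mem_segment ℝ a b)
    (right_mem_segment ℝ a b)

theorem dist_add_smul_lt {x y v : E} {R ε : ℝ} (hy : dist y x < R / 2) (hε : 0 ≤ ε)
    (h : ε < R / (2 * (1 + ‖v‖))) : dist (y + ε • v) x < R := by
  have hv : 0 < 1 + ‖v‖ := by positivity
  have h1 : dist (y + ε • v) x ≤ dist y x + ε * ‖v‖ := by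
    rw [dist_eq_norm, dist_eq_norm, add_sub_right_comm]
    refine (norm_add_le _ _).trans ?_
    rw [norm_smul, Real.norm_of_nonneg hε]
  have h2 : ε * (1 + ‖v‖) < R / 2 := by
    rw [lt_div_iff₀ (by positivity)] at h
    linarith
  nlinarith

/-- A function whose differential extends continuously to `D` is Lipschitz along an inward segment, so
it has a limit at the end of that segment. -/
theorem IsInward.exists_tendsto (hUD : U ⊆ D) (hη : ContinuousOn η D)
    (hf : ∀ x ∈ U, HasFDerivAt f (η x) x) {x v : E} {r : ℝ} (hx : x ∈ D)
    (h : IsInward U D x v r) :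
    ∃ l, Tendsto (fun ε : ℝ => f (x + ε • v)) (𝓝[>] 0) (𝓝 l) := by
  obtain ⟨M, R, hM0, hR, hM⟩ := hη.exists_norm_le_ball hx
  set δ : ℝ := min r (R / (2 * (1 + ‖v‖))) with hδ
  have hδ0 : 0 < δ := lt_min h.1 (by positivity)
  have hmem : ∀ ε ∈ Ioo 0 δ, x + ε • v ∈ U ∧ ‖η (x + ε • v)‖ ≤ M := by
    intro ε hε
    have hU := h.2 x ⟨hx, Metric.mem_ball_self h.1⟩ ε ⟨hε.1, hε.2.trans_le (min_le_left _ _)⟩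
    exact ⟨hU, hM _ ⟨hUD hU, dist_add_smul_lt (by rw [dist_self]; positivity) hε.1.le
      (hε.2.trans_le (min_le_right _ _))⟩⟩
  have hseg : ∀ ε ∈ Ioo 0 δ, ∀ ε' ∈ Ioo 0 δ, ∀ z ∈ segment ℝ (x + ε • v) (x + ε' • v),
      ∃ τ ∈ Ioo 0 δ, x + τ • v = z := by
    rintro ε hε ε' hε' z ⟨a, b, ha, hb, hab, rfl⟩
    refine ⟨a * ε + b * ε', (convex_Ioo 0 δ) hε hε' ha hb hab, ?_⟩
    rw [smul_add, smul_add, add_add_add_comm, ← add_smul, hab, one_smul, smul_smul, smul_smul,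
      add_smul]
  have hlip : LipschitzOnWith (M * ‖v‖).toNNReal (fun ε : ℝ => f (x + ε • v)) (Ioo 0 δ) := by
    refine LipschitzOnWith.of_dist_le_mul fun ε hε ε' hε' => ?_
    rw [Real.coe_toNNReal _ (by positivity)]
    have := abs_sub_le_of_segment_subset hf (a := x + ε' • v) (b := x + ε • v) (M := M)
      (fun z hz => by obtain ⟨τ, hτ, rfl⟩ := hseg ε' hε' ε hε z hz; exact (hmem τ hτ).1)
      (fun z hz => by obtain ⟨τ, hτ, rfl⟩ := hseg ε' hε' ε hε z hz; exact (hmem τ hτ).2)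
    rw [add_sub_add_left_eq_sub, ← sub_smul, norm_smul] at this
    rw [Real.dist_eq, Real.dist_eq, ← Real.norm_eq_abs (ε - ε')]
    linarith
  obtain ⟨g, hg, hgf⟩ := hlip.extend_real
  refine ⟨g 0, (hg.continuous.continuousAt.tendsto.mono_left nhdsWithin_le_nhds).congr' ?_⟩
  filter_upwards [Ioo_mem_nhdsGT hδ0] with ε hε
  exact (hgf hε).symm

/-- After a translation into `U` along `v`, a further translation along another inward vector `w`
changes `f` by a quantity that tends to zero with the size of the translation. By symmetry in `v` and
`w`, the limits of `f` along the two vectors agree. -/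
theorem IsInward.tendsto_add_sub (hUD : U ⊆ D) (hη : ContinuousOn η D)
    (hf : ∀ x ∈ U, HasFDerivAt f (η x) x) {x v w : E} {r r' : ℝ} (hx : x ∈ D)
    (h : IsInward U D x v r) (h' : IsInward U D x w r') :
    Tendsto (fun ε : ℝ => f (x + ε • v + ε • w) - f (x + ε • v)) (𝓝[>] 0) (𝓝 0) := by
  obtain ⟨M, R, hM0, hR, hM⟩ := hη.exists_norm_le_ball hx
  have hlim : Tendsto (fun ε : ℝ => M * ‖w‖ * ε) (𝓝[>] 0) (𝓝 0) := by
    have : Tendsto (fun ε : ℝ => M * ‖w‖ * ε) (𝓝 0) (𝓝 (M * ‖w‖ * 0)) :=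
      (continuous_const.mul continuous_id).tendsto 0
    rw [mul_zero] at this
    exact this.mono_left nhdsWithin_le_nhds
  refine squeeze_zero_norm' ?_ hlim
  have hpos1 : 0 < R / 2 / (2 * (1 + ‖v‖)) := by positivity
  have hpos2 : 0 < R / (2 * (1 + ‖w‖)) := by positivity
  have hpos3 : 0 < r' / (2 * (1 + ‖v‖)) := div_pos h'.1 (by positivity)
  filter_upwards [Ioo_mem_nhdsGT h.1, Ioo_mem_nhdsGT h'.1, Ioo_mem_nhdsGT hpos1,
    Ioo_mem_nhdsGT hpos2, Ioo_mem_nhdsGT hpos3] with ε h1 h2 h3 h4 h5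
  have hy : x + ε • v ∈ U := h.2 x ⟨hx, Metric.mem_ball_self h.1⟩ ε h1
  have hyr : dist (x + ε • v) x < r' :=
    dist_add_smul_lt (by rw [dist_self]; linarith [h'.1]) h5.1.le h5.2
  have hyR : dist (x + ε • v) x < R / 2 :=
    dist_add_smul_lt (by rw [dist_self]; positivity) h3.1.le h3.2
  have hmem : ∀ z ∈ segment ℝ (x + ε • v) (x + ε • v + ε • w), z ∈ U ∧ ‖η z‖ ≤ M := by
    intro z hz
    rw [segment_eq_image'] at hz
    obtain ⟨τ, hτ, rfl⟩ := hz
    simp only [add_sub_cancel_left, smul_smul]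
    have hU : x + ε • v + (τ * ε) • w ∈ U := by
      rcases hτ.1.eq_or_lt with h0 | h0
      · simpa [← h0] using hy
      · exact h'.2 _ ⟨hUD hy, hyr⟩ _ ⟨mul_pos h0 h2.1, by nlinarith [hτ.2, h2.1, h2.2]⟩
    exact ⟨hU, hM _ ⟨hUD hU, dist_add_smul_lt hyR (mul_nonneg hτ.1 h2.1.le)
      (by nlinarith [hτ.2, h4.1, h4.2])⟩⟩
  have := abs_sub_le_of_segment_subset hf (fun z hz => (hmem z hz).1) (fun z hz => (hmem z hz).2)
  rw [add_sub_cancel_left, norm_smul, Real.norm_of_nonneg h1.1.le] at this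
  rw [Real.norm_eq_abs]
  linarith

/-- A primitive `f` on `U` of a form that is continuous on `D` has boundary values on `D`: the limits
along inward vectors exist and do not depend on the vector. -/
theorem InwardAccessible.exists_boundary_values (hD : InwardAccessible U D) (hUD : U ⊆ D)
    (hη : ContinuousOn η D) (hf : ∀ x ∈ U, HasFDerivAt f (η x) x) :
    ∃ g : E → ℝ, ∀ x ∈ D, ∀ v r, IsInward U D x v r →
      Tendsto (fun ε : ℝ => f (x + ε • v)) (𝓝[>] 0) (𝓝 (g x)) := by
  have hex : ∀ x, ∃ l : ℝ, x ∈ D → ∀ v r, IsInward U D x v r →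
      Tendsto (fun ε : ℝ => f (x + ε • v)) (𝓝[>] 0) (𝓝 l) := by
    intro x
    by_cases hx : x ∈ D
    · obtain ⟨w, s, hw⟩ := hD x hx
      obtain ⟨l, hl⟩ := hw.exists_tendsto hUD hη hf hx
      refine ⟨l, fun _ v r hv => ?_⟩
      have := (hl.add (hw.tendsto_add_sub hUD hη hf hx hv)).sub
        (hv.tendsto_add_sub hUD hη hf hx hw)
      rw [add_zero, sub_zero] at this
      refine this.congr fun ε => ?_
      rw [add_right_comm x (ε • w)]
      ring
    · exact ⟨0, fun h => absurd h hx⟩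
  choose g hg using hex
  exact ⟨g, hg⟩

/-- The fundamental theorem of calculus for the boundary values `g`, along a short piece of a `C¹` path
in `D`: it holds for the translates of the path into `U` and passes to the limit. -/
theorem eventually_integral_eq_sub (hD : InwardAccessible U D) (hUD : U ⊆ D)
    (hη : ContinuousOn η D) (hf : ∀ x ∈ U, HasFDerivAt f (η x) x)
    (hg : ∀ x ∈ D, ∀ v r, IsInward U D x v r →
      Tendsto (fun ε : ℝ => f (x + ε • v)) (𝓝[>] 0) (𝓝 (g x)))
    {γ : ℝ → E} (hγ : ContDiffOn ℝ 1 γ (Icc 0 1)) (hγD : ∀ t ∈ Icc (0 : ℝ) 1, γ t ∈ D)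
    {t₀ : ℝ} (ht₀ : t₀ ∈ Icc (0 : ℝ) 1) :
    ∀ᶠ t in 𝓝[Icc 0 1] t₀,
      ∫ s in t₀..t, η (γ s) (derivWithin γ (Icc 0 1) s) = g (γ t) - g (γ t₀) := by
  obtain ⟨v, r, hv⟩ := hD _ (hγD t₀ ht₀)
  obtain ⟨M, R, hM0, hR, hM⟩ := hη.exists_norm_le_ball (hγD t₀ ht₀)
  have hr := hv.1
  have hγ' : ContinuousOn (derivWithin γ (Icc 0 1)) (Icc 0 1) :=
    hγ.continuousOn_derivWithin uniqueDiffOn_Icc_zero_one le_rfl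
  have hev : {t | γ t ∈ Metric.ball (γ t₀) (min r (R / 2))} ∈ 𝓝[Icc 0 1] t₀ :=
    (hγ.continuousOn t₀ ht₀) (Metric.ball_mem_nhds _ (lt_min hr (by positivity)))
  obtain ⟨δ, hδ, hball⟩ := Metric.mem_nhdsWithin_iff.1 hev
  filter_upwards [inter_mem_nhdsWithin (Icc 0 1) (Metric.ball_mem_nhds t₀ hδ)] with t ht
  have hsub : uIcc t₀ t ⊆ Metric.ball t₀ δ ∩ Icc 0 1 := by
    rw [← segment_eq_uIcc]
    exact ((convex_ball t₀ δ).inter (convex_Icc 0 1)).segment_subset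
      ⟨Metric.mem_ball_self hδ, ht₀⟩ ⟨ht.2, ht.1⟩
  have hsubI : uIcc t₀ t ⊆ Icc 0 1 := hsub.trans inter_subset_right
  have hr' : ∀ s ∈ uIcc t₀ t, γ s ∈ Metric.ball (γ t₀) r :=
    fun s hs => Metric.ball_subset_ball (min_le_left _ _) (hball (hsub hs))
  have hlim : ∀ s ∈ uIcc t₀ t, Tendsto (fun ε : ℝ => f (γ s + ε • v)) (𝓝[>] 0) (𝓝 (g (γ s))) :=
    fun s hs => hg _ (hγD s (hsubI hs)) _ _ (hv.of_mem_ball (hr' s hs))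
  set δ' : ℝ := min r (R / (2 * (1 + ‖v‖))) with hδ'
  have hδ0 : 0 < δ' := lt_min hr (by positivity)
  have hmem : ∀ ε ∈ Ioo 0 δ', ∀ s ∈ uIcc t₀ t,
      γ s + ε • v ∈ U ∧ ‖η (γ s + ε • v)‖ ≤ M := by
    intro ε hε s hs
    have hU := hv.2 (γ s) ⟨hγD s (hsubI hs), hr' s hs⟩ ε
      ⟨hε.1, hε.2.trans_le (min_le_left _ _)⟩
    exact ⟨hU, hM _ ⟨hUD hU, dist_add_smul_lt
      ((hball (hsub hs)).trans_le (min_le_right _ _)) hε.1.le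
      (hε.2.trans_le (min_le_right _ _))⟩⟩
  have hcont : ∀ ε ∈ Ioo 0 δ', ContinuousOn
      (fun s => η (γ s + ε • v) (derivWithin γ (Icc 0 1) s)) (uIcc t₀ t) := by
    intro ε hε
    refine ContinuousOn.clm_apply (hη.comp ?_ fun s hs => hUD (hmem ε hε s hs).1) (hγ'.mono hsubI)
    exact (hγ.continuousOn.mono hsubI).add continuousOn_const
  have hFTC : ∀ ε ∈ Ioo 0 δ', ∫ s in t₀..t, η (γ s + ε • v) (derivWithin γ (Icc 0 1) s)
      = f (γ t + ε • v) - f (γ t₀ + ε • v) := by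
    intro ε hε
    refine intervalIntegral.integral_eq_sub_of_hasDeriv_right
      (f := fun s => f (γ s + ε • v)) (fun s hs => ?_) (fun s hs => ?_)
      (hcont ε hε).intervalIntegrable
    · refine ContinuousAt.comp_continuousWithinAt (f := fun s => γ s + ε • v) (g := f)
        (hf _ (hmem ε hε s hs).1).continuousAt ?_
      exact ((hγ.continuousOn s (hsubI hs)).mono hsubI).add continuousWithinAt_const
    · have hs' : s ∈ uIcc t₀ t := Ioo_subset_Icc_self hs
      have hnhds : Icc (0 : ℝ) 1 ∈ 𝓝 s :=
        mem_of_superset (Ioo_mem_nhds hs.1 hs.2) (Ioo_subset_Icc_self.trans hsubI)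
      have hd : HasDerivAt γ (derivWithin γ (Icc 0 1) s) s :=
        ((hγ.differentiableOn one_ne_zero s (hsubI hs')).hasDerivWithinAt).hasDerivAt hnhds
      exact ((hf _ (hmem ε hε s hs').1).comp_hasDerivAt s (hd.add_const _)).hasDerivWithinAt
  have hint : Tendsto
      (fun ε : ℝ => ∫ s in t₀..t, η (γ s + ε • v) (derivWithin γ (Icc 0 1) s)) (𝓝[>] 0)
      (𝓝 (∫ s in t₀..t, η (γ s) (derivWithin γ (Icc 0 1) s))) := by
    refine intervalIntegral.tendsto_integral_filter_of_dominated_convergence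
      (fun s => M * ‖derivWithin γ (Icc 0 1) s‖) ?_ ?_ ?_ ?_
    · filter_upwards [Ioo_mem_nhdsGT hδ0] with ε hε
      exact ((hcont ε hε).mono uIoc_subset_uIcc).aestronglyMeasurable measurableSet_uIoc
    · filter_upwards [Ioo_mem_nhdsGT hδ0] with ε hε
      refine Eventually.of_forall fun s hs => ?_
      exact (ContinuousLinearMap.le_opNorm _ _).trans
        (mul_le_mul_of_nonneg_right (hmem ε hε s (uIoc_subset_uIcc hs)).2 (norm_nonneg _))
    · exact (continuousOn_const.mul (hγ'.mono hsubI).norm).intervalIntegrable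
    · refine Eventually.of_forall fun s hs => ?_
      have hs' := uIoc_subset_uIcc hs
      have h1 : Tendsto (fun ε : ℝ => γ s + ε • v) (𝓝[>] 0) (𝓝[D] (γ s)) := by
        refine tendsto_nhdsWithin_iff.2 ⟨?_, ?_⟩
        · have : Tendsto (fun ε : ℝ => γ s + ε • v) (𝓝 0) (𝓝 (γ s + (0 : ℝ) • v)) :=
            (continuous_const.add (continuous_id.smul continuous_const)).tendsto 0
          rw [zero_smul, add_zero] at this
          exact this.mono_left nhdsWithin_le_nhds
        · filter_upwards [Ioo_mem_nhdsGT hδ0] with ε hε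
          exact hUD (hmem ε hε s hs').1
      exact ((ContinuousLinearMap.apply ℝ ℝ _).continuous.tendsto _).comp
        ((hη _ (hγD s (hsubI hs'))).tendsto.comp h1)
  refine tendsto_nhds_unique hint (((hlim t right_mem_uIcc).sub (hlim t₀ left_mem_uIcc)).congr' ?_)
  filter_upwards [Ioo_mem_nhdsGT hδ0] with ε hε
  exact (hFTC ε hε).symm

theorem integral_eq_sub_of_boundary_values (hD : InwardAccessible U D) (hUD : U ⊆ D)
    (hη : ContinuousOn η D) (hf : ∀ x ∈ U, HasFDerivAt f (η x) x)
    (hg : ∀ x ∈ D, ∀ v r, IsInward U D x v r →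
      Tendsto (fun ε : ℝ => f (x + ε • v)) (𝓝[>] 0) (𝓝 (g x)))
    {γ : ℝ → E} (hγ : ContDiffOn ℝ 1 γ (Icc 0 1)) (hγD : ∀ t ∈ Icc (0 : ℝ) 1, γ t ∈ D) :
    ∫ s in 0..1, η (γ s) (derivWithin γ (Icc 0 1) s) = g (γ 1) - g (γ 0) := by
  have hγ' : ContinuousOn (derivWithin γ (Icc 0 1)) (Icc 0 1) :=
    hγ.continuousOn_derivWithin uniqueDiffOn_Icc_zero_one le_rfl
  have hcont : ContinuousOn (fun s => η (γ s) (derivWithin γ (Icc 0 1) s)) (Icc 0 1) :=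
    (hη.comp hγ.continuousOn hγD).clm_apply hγ'
  have hii : ∀ a ∈ Icc (0 : ℝ) 1, ∀ b ∈ Icc (0 : ℝ) 1, IntervalIntegrable
      (fun s => η (γ s) (derivWithin γ (Icc 0 1) s)) volume a b := fun a ha b hb =>
    (hcont.mono (ordConnected_Icc.uIcc_subset ha hb)).intervalIntegrable
  set k : ℝ → ℝ := fun t => g (γ t) - ∫ s in 0..t, η (γ s) (derivWithin γ (Icc 0 1) s) with hk
  have h0 : (0 : ℝ) ∈ Icc (0 : ℝ) 1 := left_mem_Icc.2 zero_le_one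
  have h1 : (1 : ℝ) ∈ Icc (0 : ℝ) 1 := right_mem_Icc.2 zero_le_one
  have hloc : ∀ t₀ ∈ Icc (0 : ℝ) 1, ∀ᶠ t in 𝓝[Icc 0 1] t₀, k t₀ = k t := by
    intro t₀ ht₀
    filter_upwards [eventually_integral_eq_sub hD hUD hη hf hg hγ hγD ht₀, self_mem_nhdsWithin]
      with t ht htI
    rw [hk]
    have := intervalIntegral.integral_add_adjacent_intervals (hii 0 h0 t₀ ht₀) (hii t₀ ht₀ t htI)
    dsimp only
    rw [← this, ht]
    ring
  have hconst : k 0 = k 1 := isPreconnected_Icc.induction₂ (fun a b => k a = k b) hloc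
    (fun _ _ _ _ _ _ h h' => h.trans h') (fun _ _ _ _ h => h.symm) h0 h1
  simp only [hk, intervalIntegral.integral_same] at hconst
  linarith

end BoundaryValues

/-! ### Path integrals -/

section PathIntegrals

variable {n : ℕ} {U D : Set (Eucl n)} {F : Eucl n → Eucl n}

theorem continuousOn_innerSL_comp (hF : ContinuousOn F D) :
    ContinuousOn (fun x => innerSL ℝ (F x)) D :=
  (innerSL ℝ).continuous.comp_continuousOn hF

theorem IsPiecewiseC1.segment (a b : Eucl n) : IsPiecewiseC1 (Path.segment a b) := by
  refine .smooth _ (ContDiffOn.congr (f := AffineMap.lineMap a b) ?_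
    (Path.eqOn_extend_segment a b))
  simp only [funext (AffineMap.lineMap_apply_module' a b)]
  fun_prop

theorem IsPiecewiseC1.curveIntegrable (hF : ContinuousOn F D) {a b : Eucl n} {γ : Path a b}
    (hγ : IsPiecewiseC1 γ) (hD : ∀ s, γ s ∈ D) :
    CurveIntegrable (fun y => innerSL ℝ (F y)) γ := by
  induction hγ with
  | smooth γ h => exact (continuousOn_innerSL_comp hF).curveIntegrable_of_contDiffOn h hD
  | trans γ₁ γ₂ _ _ ih₁ ih₂ =>
    rw [← range_subset_iff, Path.trans_range, union_subset_iff, range_subset_iff,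
      range_subset_iff] at hD
    exact (ih₁ hD.1).trans (ih₂ hD.2)

theorem IsPiecewiseC1.curveIntegral_eq_sub (hF : ContinuousOn F D) (hD : InwardAccessible U D)
    (hUD : U ⊆ D) {f g : Eucl n → ℝ} (hf : ∀ x ∈ U, HasFDerivAt f (innerSL ℝ (F x)) x)
    (hg : ∀ x ∈ D, ∀ v r, IsInward U D x v r →
      Tendsto (fun ε : ℝ => f (x + ε • v)) (𝓝[>] 0) (𝓝 (g x)))
    {a b : Eucl n} {γ : Path a b} (hγ : IsPiecewiseC1 γ) (hγD : ∀ s, γ s ∈ D) :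
    ∫ᶜ y in γ, innerSL ℝ (F y) = g b - g a := by
  induction hγ with
  | smooth γ h =>
    have := integral_eq_sub_of_boundary_values hD hUD (continuousOn_innerSL_comp hF) hf hg h
      (fun t ht => by rw [Path.extend_apply _ ht]; exact hγD _)
    rw [Path.extend_zero, Path.extend_one] at this
    rw [← this, curveIntegral_def]
    simp only [curveIntegralFun_def]
  | trans γ₁ γ₂ h₁ h₂ ih₁ ih₂ =>
    rw [← range_subset_iff, Path.trans_range, union_subset_iff, range_subset_iff,
      range_subset_iff] at hγD
    rw [curveIntegral_trans (h₁.curveIntegrable hF hγD.1) (h₂.curveIntegrable hF hγD.2),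
      ih₁ hγD.1, ih₂ hγD.2]
    ring

/-- If `U` is simply connected, the path integral of a curl-free field is independent of the path, also
for paths in `D` that run along the boundary. -/
theorem exists_isPathIntegral (hF : ContinuousOn F D) (hD : InwardAccessible U D)
    (hUD : U ⊆ D) (hU : IsSimplyConnected U) (hUo : IsOpen U) (hFU : DifferentiableOn ℝ F U)
    (hsymm : ∀ x ∈ U, ∀ j k : Fin n, (fderiv ℝ F x (EuclideanSpace.single j 1)) k
      = (fderiv ℝ F x (EuclideanSpace.single k 1)) j) (x₀ : Eucl n) (c : ℝ) :
    ∃ u, IsPathIntegral D F x₀ c u := by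
  have hη : ∀ x ∈ U, HasFDerivAt (fun y => innerSL ℝ (F y)) ((innerSL ℝ).comp (fderiv ℝ F x)) x :=
    fun x hx => (innerSL ℝ).hasFDerivAt.comp x (hFU.differentiableAt (hUo.mem_nhds hx)).hasFDerivAt
  obtain ⟨f, hf⟩ := hU.exists_forall_hasFDerivAt hUo (η := fun y => innerSL ℝ (F y))
    (fun x hx => (hη x hx).differentiableAt.differentiableWithinAt) (by
      intro x hx v w
      rw [(hη x hx).fderiv]
      -- A bilinear form that is symmetric on the standard basis is symmetric.
      have hlin : ((innerSL ℝ).comp (fderiv ℝ F x) : Eucl n →L[ℝ] Eucl n →L[ℝ] ℝ).toLinearMap₁₂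
          = ((innerSL ℝ).comp (fderiv ℝ F x) : Eucl n →L[ℝ] Eucl n →L[ℝ] ℝ).toLinearMap₁₂.flip := by
        refine (EuclideanSpace.basisFun (Fin n) ℝ).toBasis.ext fun j =>
          (EuclideanSpace.basisFun (Fin n) ℝ).toBasis.ext fun k => ?_
        have := hsymm x hx j k
        simpa [EuclideanSpace.inner_single_right] using this
      exact congrArg (fun B => B v w) hlin)
  obtain ⟨g, hg⟩ := hD.exists_boundary_values hUD (continuousOn_innerSL_comp hF) hf
  refine ⟨fun x => g x - g x₀ + c, fun x γ hγ hγD => ?_⟩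
  rw [hγ.curveIntegral_eq_sub hF hD hUD hf hg hγD]

theorem exists_isPiecewiseC1_of_isConnected (hUo : IsOpen U) (hU : IsPreconnected U)
    {a b : Eucl n} (ha : a ∈ U) (hb : b ∈ U) :
    ∃ γ : Path a b, IsPiecewiseC1 γ ∧ ∀ s, γ s ∈ U := by
  refine hU.induction₂' (fun a b => ∃ γ : Path a b, IsPiecewiseC1 γ ∧ ∀ s, γ s ∈ U) ?_ ?_ ha hb
  · intro x hx
    obtain ⟨r, hr, hrU⟩ := Metric.isOpen_iff.1 hUo x hx
    have hseg : ∀ y z, y ∈ Metric.ball x r → z ∈ Metric.ball x r →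
        ∀ s, Path.segment y z s ∈ U := fun y z hy hz s =>
      hrU ((convex_ball x r).segment_subset hy hz (by
        rw [← Path.range_segment]; exact mem_range_self s))
    filter_upwards [mem_nhdsWithin_of_mem_nhds (Metric.ball_mem_nhds x hr)] with y hy
    exact ⟨⟨_, .segment x y, hseg x y (Metric.mem_ball_self hr) hy⟩,
      ⟨_, .segment y x, hseg y x hy (Metric.mem_ball_self hr)⟩⟩
  · rintro x y z - - - ⟨γ₁, h₁, hU₁⟩ ⟨γ₂, h₂, hU₂⟩
    refine ⟨γ₁.trans γ₂, .trans _ _ h₁ h₂, ?_⟩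
    rw [← range_subset_iff, Path.trans_range, union_subset_iff, range_subset_iff,
      range_subset_iff]
    exact ⟨hU₁, hU₂⟩

/-- Every point of `U` can be reached from a point of `D`, possibly on the boundary, by a piecewise
`C¹` path in `D`. Without this, the values of a function that satisfies `IsPathIntegral` would be
unconstrained at some points of `U`. -/
theorem InwardAccessible.exists_isPiecewiseC1 (hD : InwardAccessible U D) (hUD : U ⊆ D)
    (hUo : IsOpen U) (hU : IsPreconnected U) {a b : Eucl n} (ha : a ∈ D) (hb : b ∈ U) :
    ∃ γ : Path a b, IsPiecewiseC1 γ ∧ ∀ s, γ s ∈ D := by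
  obtain ⟨v, r, hr, hv⟩ := hD a ha
  have hv' := hv a ⟨ha, Metric.mem_ball_self hr⟩
  obtain ⟨γ, hγ, hγU⟩ := exists_isPiecewiseC1_of_isConnected hUo hU
    (hv' (r / 2) ⟨by positivity, by linarith⟩) hb
  refine ⟨(Path.segment a (a + (r / 2) • v)).trans γ, .trans _ _ (.segment _ _) hγ, ?_⟩
  rw [← range_subset_iff, Path.trans_range, union_subset_iff, Path.range_segment, range_subset_iff]
  refine ⟨fun z hz => ?_, fun s => hUD (hγU s)⟩
  rw [segment_eq_image'] at hz
  obtain ⟨τ, hτ, rfl⟩ := hz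
  simp only [add_sub_cancel_left, smul_smul]
  rcases hτ.1.eq_or_lt with h0 | h0
  · simpa [← h0] using ha
  · exact hUD (hv' _ ⟨by positivity, by nlinarith [hτ.2]⟩)

theorem IsPathIntegral.apply_base {x₀ : Eucl n} {c : ℝ} {u : Eucl n → ℝ}
    (hu : IsPathIntegral D F x₀ c u) (hx₀ : x₀ ∈ D) : u x₀ = c := by
  have hrefl : IsPiecewiseC1 (Path.refl x₀) := by
    rw [← Path.segment_same]
    exact .segment x₀ x₀
  simpa using hu x₀ (Path.refl x₀) hrefl fun _ => hx₀

theorem IsPathIntegral.hasGradientAt {x₀ : Eucl n} {c : ℝ} {u : Eucl n → ℝ}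
    (hu : IsPathIntegral D F x₀ c u) (hF : ContinuousOn F D) (hD : InwardAccessible U D)
    (hUD : U ⊆ D) (hUo : IsOpen U) (hU : IsPreconnected U) (hx₀ : x₀ ∈ D) {x : Eucl n}
    (hx : x ∈ U) : HasGradientAt u (F x) x := by
  obtain ⟨γ, hγ, hγD⟩ := hD.exists_isPiecewiseC1 hUD hUo hU hx₀ hx
  obtain ⟨r, hr, hrU⟩ := Metric.isOpen_iff.1 hUo x hx
  have hev : ∀ y ∈ Metric.ball x r,
      u y = u x + ∫ᶜ z in .segment x y, innerSL ℝ (F z) := by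
    intro y hy
    have hseg : ∀ s, Path.segment x y s ∈ D := fun s =>
      hUD (hrU ((convex_ball x r).segment_subset (Metric.mem_ball_self hr) hy (by
        rw [← Path.range_segment]; exact mem_range_self s)))
    have hall : ∀ s, (γ.trans (Path.segment x y)) s ∈ D := by
      rw [← range_subset_iff, Path.trans_range, union_subset_iff, range_subset_iff,
        range_subset_iff]
      exact ⟨hγD, hseg⟩
    rw [hu y _ (.trans _ _ hγ (.segment x y)) hall, hu x γ hγ hγD,
      curveIntegral_trans (hγ.curveIntegrable hF hγD)
        ((IsPiecewiseC1.segment x y).curveIntegrable hF hseg)]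
    ring
  rw [hasGradientAt_iff_hasFDerivAt]
  have hcont : ∀ᶠ z in 𝓝 x, ContinuousAt (fun z => innerSL ℝ (F z)) z := by
    filter_upwards [hUo.mem_nhds hx] with z hz
    exact ((continuousOn_innerSL_comp hF).mono hUD).continuousAt (hUo.mem_nhds hz)
  refine ((HasFDerivAt.curveIntegral_segment_source' hcont).const_add (u x)).congr_of_eventuallyEq ?_
  filter_upwards [Metric.ball_mem_nhds x hr] with y hy
  exact hev y hy

theorem contDiffOn_one_of_hasGradientAt {u : Eucl n → ℝ} (hUo : IsOpen U) (hF : ContinuousOn F U)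
    (hu : ∀ x ∈ U, HasGradientAt u (F x) x) : ContDiffOn ℝ 1 u U := by
  have h : ∀ x ∈ U, HasFDerivAt u (innerSL ℝ (F x)) x := fun x hx => (hu x hx).hasFDerivAt
  rw [show (1 : WithTop ℕ∞) = 0 + 1 by simp, contDiffOn_succ_iff_fderiv_of_isOpen hUo]
  refine ⟨fun x hx => (h x hx).differentiableAt.differentiableWithinAt, by simp, ?_⟩
  rw [contDiffOn_zero]
  exact (continuousOn_innerSL_comp hF).congr fun x hx => (h x hx).fderiv

end PathIntegrals

/-! ### Classical and weak gradients -/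

section WeakGradients

variable {n : ℕ} {Ω : Set (Eucl n)} {u : Eucl n → ℝ} {F G : Eucl n → Eucl n}

theorem integrable_smul_of_tsupport_subset {X : Type*} [NormedAddCommGroup X] [NormedSpace ℝ X]
    {a : Eucl n → ℝ} {b : Eucl n → X} (ha : Continuous a) (hac : HasCompactSupport a)
    (hsub : tsupport a ⊆ Ω) (hb : LocallyIntegrableOn b Ω) : Integrable (fun x => a x • b x) := by
  have h : IntegrableOn (fun x => a x • b x) (tsupport a) :=
    (hb.integrableOn_compact_subset hsub hac).continuousOn_smul ha.continuousOn
      hac.isCompact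
  rwa [integrableOn_iff_integrable_of_support_subset] at h
  exact (Function.support_smul_subset_left a b).trans (subset_tsupport a)

theorem support_gradient_subset (φ : Eucl n → ℝ) : Function.support (gradient φ) ⊆ tsupport φ := by
  intro x hx
  by_contra h
  have h0 : fderiv ℝ φ x = 0 :=
    image_eq_zero_of_notMem_tsupport fun h' => h (tsupport_fderiv_subset ℝ h')
  exact hx (by simp [gradient, h0])

/-- The classical gradient of a `C¹` function on an open set is a weak gradient. -/
theorem integral_smul_gradient_eq_neg (hΩ : IsOpen Ω) (hF : ContinuousOn F Ω)
    (hu : ∀ x ∈ Ω, HasGradientAt u (F x) x) {φ : Eucl n → ℝ} (hφ : ContDiff ℝ ∞ φ)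
    (hφc : HasCompactSupport φ) (hφΩ : tsupport φ ⊆ Ω) :
    ∫ x, u x • gradient φ x = -∫ x, φ x • F x := by
  have huc : ContinuousOn u Ω := fun x hx => (hu x hx).continuousAt.continuousWithinAt
  have hdφ : ∀ x, DifferentiableAt ℝ φ x := fun x => (hφ.differentiable (by simp)).differentiableAt
  have hgrad : Continuous (gradient φ) := by
    have h : Continuous (fderiv ℝ φ) := hφ.continuous_fderiv (by simp)
    have h' : Continuous ((InnerProductSpace.toDual ℝ (Eucl n)).symm) :=
      LinearIsometryEquiv.continuous _
    exact h'.comp h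
  have hgradc : HasCompactSupport (gradient φ) := hφc.mono' (support_gradient_subset φ)
  have hgrads : tsupport (gradient φ) ⊆ Ω :=
    (closure_minimal (support_gradient_subset φ) (isClosed_tsupport φ)).trans hφΩ
  have hi1 : Integrable fun x => u x • gradient φ x := by
    refine Continuous.integrable_of_hasCompactSupport (continuous_of_tsupport fun x hx => ?_)
      (hgradc.mono (Function.support_smul_subset_right u _))
    have hx' : x ∈ Ω := hgrads (closure_mono (Function.support_smul_subset_right u _) hx)
    exact (huc.continuousAt (hΩ.mem_nhds hx')).smul hgrad.continuousAt
  have hi2 : Integrable fun x => φ x • F x := integrable_smul_of_tsupport_subset hφ.continuous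
    hφc hφΩ (hF.locallyIntegrableOn hΩ.measurableSet)
  have hin1 : ∀ w x, inner ℝ w (u x • gradient φ x) = fderiv ℝ φ x w * u x := by
    intro w x
    rw [inner_smul_right, real_inner_comm, (hdφ x).hasGradientAt.hasFDerivAt.fderiv, mul_comm]
    rfl
  have hin2 : ∀ w x, inner ℝ w (φ x • F x) = φ x * fderiv ℝ u x w := by
    intro w x
    rw [inner_smul_right]
    by_cases hx : x ∈ tsupport φ
    · rw [(hu x (hφΩ hx)).hasFDerivAt.fderiv, real_inner_comm]
      simp
    · rw [image_eq_zero_of_notMem_tsupport hx, zero_mul, zero_mul]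
  refine ext_inner_left ℝ fun w => ?_
  rw [inner_neg_right, ← integral_inner hi1, ← integral_inner hi2]
  simp only [hin1, hin2]
  rw [eq_neg_iff_add_eq_zero, add_comm, ← eq_neg_iff_add_eq_zero]
  refine integral_mul_fderiv_eq_neg_fderiv_mul_of_integrable (μ := volume) (𝕜 := ℝ) ?_ ?_ ?_
    (fun x _ => hdφ x) (fun x hx => (hu x (hφΩ hx)).hasFDerivAt.differentiableAt)
  · exact (hi1.const_inner w).congr (Eventually.of_forall (hin1 w))
  · exact (hi2.const_inner w).congr (Eventually.of_forall (hin2 w))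
  · exact integrable_smul_of_tsupport_subset hφ.continuous hφc hφΩ
      (huc.locallyIntegrableOn hΩ.measurableSet)

theorem IsWeakGradient.ae_eq (hΩ : IsOpen Ω) (hF : ContinuousOn F Ω)
    (hu : ∀ x ∈ Ω, HasGradientAt u (F x) x) (h : IsWeakGradient Ω u G) :
    G =ᵐ[volume.restrict Ω] F := by
  obtain ⟨-, hG, hφ⟩ := h
  have hFi : LocallyIntegrableOn F Ω := hF.locallyIntegrableOn hΩ.measurableSet
  have h0 : ∀ᵐ x, x ∈ Ω → (G - F) x = 0 := by
    refine hΩ.ae_eq_zero_of_integral_contDiff_smul_eq_zero (hG.sub hFi) fun φ hs hc hsub => ?_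
    have hcl : ∀ x ∉ Ω, φ x • G x = 0 := fun x hx => by
      rw [image_eq_zero_of_notMem_tsupport fun h => hx (hsub h), zero_smul]
    have hcl' : ∀ x ∉ Ω, u x • gradient φ x = 0 := fun x hx => by
      rw [Function.notMem_support.1 fun h => hx (hsub (support_gradient_subset φ h)), smul_zero]
    have hGi : Integrable fun x => φ x • G x :=
      integrable_smul_of_tsupport_subset hs.continuous hc hsub hG
    have hFi' : Integrable fun x => φ x • F x :=
      integrable_smul_of_tsupport_subset hs.continuous hc hsub hFi
    have e1 := hφ φ hs hc hsub
    rw [setIntegral_eq_integral_of_forall_compl_eq_zero hcl',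
      setIntegral_eq_integral_of_forall_compl_eq_zero hcl,
      integral_smul_gradient_eq_neg hΩ hF hu hs hc hsub, neg_inj] at e1
    simp only [Pi.sub_apply, smul_sub]
    rw [integral_sub hGi hFi', e1, sub_self]
  rw [Filter.EventuallyEq, ae_restrict_iff' hΩ.measurableSet]
  filter_upwards [h0] with x hx hxΩ
  exact sub_eq_zero.1 (hx hxΩ)

end WeakGradients

/-! ### The boundary value problems and the energies -/

section BoundaryValueProblems

variable {n : ℕ} {Ω Γu Γt D : Set (Eucl n)} {p p' q : ℝ≥0∞} {f t u g : Eucl n → ℝ} {ν lam : ℝ}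
  {σ τ G : Eucl n → Eucl n} {ζ : Eucl n → ℝ}

/-- The condition that the test function vanish off `closure Ω` is void. -/
theorem SolvesDivBVP.integral_inner_eq (hσ : SolvesDivBVP Ω Γu Γt p q f t (closure Ω) σ)
    (hu : IsAdmissible Ω Γu Γt p q u G g) :
    ∫ x in Ω, inner ℝ (σ x) (G x) =
      (∫ x in Ω, f x * u x) + ∫ x in Γt, t x * g x ∂(surfaceMeasure n) := by
  have key := hσ.2 u G g hu (by
    rw [sdiff_eq_empty.2 subset_closure, Measure.restrict_empty, ae_zero]
    exact eventually_bot)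
  rwa [inter_eq_left.2 subset_closure] at key

/-- Test functions that vanish off `D` do not see the field there, so a field that agrees on `D` with
a solution of the full problem solves the problem on `D`. -/
theorem SolvesDivBVP.congr_on_subset (hσ : SolvesDivBVP Ω Γu Γt p q f t (closure Ω) σ)
    (hΩ : IsOpen Ω) (hD : D ⊆ closure Ω) (hDm : MeasurableSet D) (h : EqOn τ σ (D ∩ Ω)) :
    SolvesDivBVP Ω Γu Γt p q f t D τ := by
  have hmem : MemLp σ (4 / 3) (volume.restrict Ω) := by
    simpa only [inter_eq_left.2 (subset_closure (s := Ω))] using hσ.1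
  have hm : MeasurableSet (Ω ∩ D) := hΩ.measurableSet.inter hDm
  have heq : ∀ x ∈ Ω ∩ D, τ x = σ x := fun x hx => h ⟨hx.2, hx.1⟩
  refine ⟨(hmem.mono_measure (Measure.restrict_mono_set _ inter_subset_left)).ae_eq
    ((ae_restrict_iff' hm).2 (Eventually.of_forall fun x hx => (heq x hx).symm)), ?_⟩
  intro φ Gφ gφ hφ hvan
  have hdiff : ∀ᵐ x, x ∈ Ω \ (Ω ∩ D) → φ x = 0 ∧ Gφ x = 0 := by
    rw [sdiff_self_inter]
    exact (ae_restrict_iff' (hΩ.measurableSet.diff hDm)).1 hvan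
  have e1 : ∫ x in Ω ∩ D, inner ℝ (τ x) (Gφ x) = ∫ x in Ω ∩ D, inner ℝ (σ x) (Gφ x) :=
    setIntegral_congr_fun hm fun x hx => by simp only [heq x hx]
  have e2 : ∫ x in Ω, inner ℝ (σ x) (Gφ x) = ∫ x in Ω ∩ D, inner ℝ (σ x) (Gφ x) :=
    setIntegral_eq_of_subset_of_ae_sdiff_eq_zero hΩ.measurableSet.nullMeasurableSet
      inter_subset_left (hdiff.mono fun x hx hxd => by rw [(hx hxd).2, inner_zero_right])
  have e3 : ∫ x in Ω, f x * φ x = ∫ x in Ω ∩ D, f x * φ x :=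
    setIntegral_eq_of_subset_of_ae_sdiff_eq_zero hΩ.measurableSet.nullMeasurableSet
      inter_subset_left (hdiff.mono fun x hx hxd => by rw [(hx hxd).1, mul_zero])
  rw [e1, ← e2, ← e3]
  exact hσ.integral_inner_eq hφ

/-- If `z` is a nonzero root of the cubic of `s`, then `z` is the derivative of the double well at
`z⁻¹ • s`, and the stress there is `s`. -/
theorem stress_smul {s : Eucl n} {z : ℝ} (hν : ν ≠ 0) (hz : z ≠ 0)
    (h : ‖s‖ ^ 2 = 2 * z ^ 2 * (lam + z / ν)) :
    ν * (‖z⁻¹ • s‖ ^ 2 / 2 - lam) = z ∧ stress ν lam (z⁻¹ • s) = s := by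
  have h1 : ν * (‖z⁻¹ • s‖ ^ 2 / 2 - lam) = z := by
    rw [norm_smul, mul_pow, h, norm_inv, inv_pow, Real.norm_eq_abs, sq_abs]
    field_simp
    ring
  refine ⟨h1, ?_⟩
  rw [stress, h1, smul_smul, mul_inv_cancel₀ hz, one_smul]

theorem compatRegion_root (hν : 0 < ν) (hlam : 0 < lam) {i : Fin 3} {x : Eucl n}
    (hx : x ∈ compatRegion Ω ν lam σ i) :
    dualField ν lam σ i x ≠ 0 ∧
      ‖σ x‖ ^ 2 = 2 * dualField ν lam σ i x ^ 2 * (lam + dualField ν lam σ i x / ν) := by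
  obtain ⟨-, him, hne, -⟩ := hx
  have hre : ((dualField ν lam σ i x : ℝ) : ℂ) = dualRoot ν lam (‖σ x‖ ^ 2) i :=
    Complex.ext rfl (by rw [him, Complex.ofReal_im])
  refine ⟨fun h => hne (by rw [← hre, h, Complex.ofReal_zero]), ?_⟩
  have := (cubic_iff_dualRoot hν hlam (sq_nonneg ‖σ x‖) _).2 ⟨i, hre⟩
  exact_mod_cast this

/-- Pointwise, all densities are polynomials in `|∇u|²` once `σ = ζ ∇u` and `ζ = ν (|∇u|²/2 - lam)`.
The linear terms of the energies are turned into `∫ σ · ∇u` by testing the boundary value problem with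
`u` itself. -/
theorem integrable_and_no_duality_gap (hΩ_bdd : Bornology.IsBounded Ω) (hν : 0 < ν)
    (hpp' : ENNReal.HolderConjugate p p') (hf : MemLp f p' (volume.restrict Ω))
    (hσ : SolvesDivBVP Ω Γu Γt p q f t (closure Ω) σ) (hu : IsAdmissible Ω Γu Γt p q u G g)
    (hζ : ∀ᵐ x ∂volume.restrict Ω, ζ x ≠ 0 ∧ σ x = ζ x • G x ∧ ζ x = ν * (‖G x‖ ^ 2 / 2 - lam)) :
    IntegrableOn (fun x => doubleWell ν lam (G x)) Ω ∧
      IntegrableOn (dualDensity ν lam σ ζ) Ω ∧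
      primalEnergy Ω Γt ν lam f t u G g = totalComplementaryEnergy Ω Γt ν lam f t u G g ζ ∧
      primalEnergy Ω Γt ν lam f t u G g = dualEnergy Ω ν lam σ ζ := by
  have : IsFiniteMeasure (volume.restrict Ω) :=
    isFiniteMeasure_restrict.2 hΩ_bdd.measure_lt_top.ne
  have h4 : Integrable (fun x => ‖G x‖ ^ 4) (volume.restrict Ω) := by
    exact_mod_cast hu.gradient_memLp.integrable_norm_pow (p := 4) (by norm_num)
  have h2 : Integrable (fun x => ‖G x‖ ^ 2) (volume.restrict Ω) :=
    (hu.gradient_memLp.mono_exponent (p := 2) (by norm_num)).integrable_norm_pow (p := 2)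
      (by norm_num)
  have hW : Integrable (fun x => doubleWell ν lam (G x)) (volume.restrict Ω) := by
    refine ((h4.const_mul (ν / 8)).sub ((h2.const_mul (ν * lam / 2)).sub
      (integrable_const (ν * lam ^ 2 / 2)))).congr (Eventually.of_forall fun x => ?_)
    simp only [Pi.sub_apply, doubleWell]
    ring
  have hdual : ∀ᵐ x ∂volume.restrict Ω, dualDensity ν lam σ ζ x
      = ν * (3 / 4 * ‖G x‖ ^ 4 - lam * ‖G x‖ ^ 2 - lam ^ 2) := by
    filter_upwards [hζ] with x ⟨h0, h1, h2⟩
    have hsq : ‖σ x‖ ^ 2 / ζ x = ζ x * ‖G x‖ ^ 2 := by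
      rw [h1, norm_smul, mul_pow, Real.norm_eq_abs, sq_abs]
      field_simp
    rw [dualDensity, hsq, h2]
    field_simp
    ring
  have hV : Integrable (dualDensity ν lam σ ζ) (volume.restrict Ω) := by
    refine (((h4.const_mul (3 / 4)).sub (h2.const_mul lam)).sub
      (integrable_const (lam ^ 2)) |>.const_mul ν).congr ?_
    filter_upwards [hdual] with x hx
    simp only [Pi.sub_apply, hx]
  have hfu : Integrable (fun x => f x * u x) (volume.restrict Ω) :=
    haveI := hpp'.symm
    hf.integrable_mul hu.memLp
  refine ⟨hW, hV, ?_, ?_⟩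
  · rw [primalEnergy, totalComplementaryEnergy, ← integral_sub hW hfu]
    congr 1
    refine integral_congr_ae ?_
    filter_upwards [hζ] with x ⟨_, _, h⟩
    rw [h, doubleWell]
    field_simp
    ring
  · rw [primalEnergy, dualEnergy, sub_sub, ← hσ.integral_inner_eq hu, ← integral_const_mul]
    have hinner : (fun x => inner ℝ (σ x) (G x)) =ᵐ[volume.restrict Ω]
        fun x => doubleWell ν lam (G x) - -(1 / 2) * dualDensity ν lam σ ζ x := by
      filter_upwards [hζ, hdual] with x ⟨_, h1, h2⟩ h3
      rw [h3, h1, real_inner_smul_left, real_inner_self_eq_norm_sq, h2, doubleWell]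
      ring
    rw [integral_congr_ae hinner, integral_sub hW (hV.const_mul _), sub_sub_cancel]

end BoundaryValueProblems

theorem theorem2p3 {n : ℕ} (hn : 1 ≤ n) (Ω Γu Γt : Set (Eucl n))
    (hΩ_open : IsOpen Ω) (hΩ_bdd : Bornology.IsBounded Ω) (hΩ_C1 : HasC1Boundary Ω)
    (hΓ : Γu ∪ Γt = frontier Ω) (hΓu : MeasurableSet Γu) (hΓt : MeasurableSet Γt)
    (ν lam : ℝ) (hν : 0 < ν) (hlam : 0 < lam)
    (p p' q q' : ℝ≥0∞) (hp : 2 ≤ p) (hq : 2 ≤ q)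
    (hpp' : ENNReal.HolderConjugate p p') (hqq' : ENNReal.HolderConjugate q q')
    (f t : Eucl n → ℝ) (hf : MemLp f p' (volume.restrict Ω))
    (ht : MemLp t q' ((surfaceMeasure n).restrict Γt))
    (σ : Eucl n → Eucl n) (hσ : SolvesDivBVP Ω Γu Γt p q f t (closure Ω) σ) :
    (∀ x ∈ closure Ω,
      (∀ ζ : ℂ, (((‖σ x‖ ^ 2 : ℝ) : ℂ) = 2 * ζ ^ 2 * (lam + ζ / ν) ↔
        ∃ i, ζ = dualRoot ν lam (‖σ x‖ ^ 2) i)) ∧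
      {ζ : ℝ | ‖σ x‖ ^ 2 = 2 * ζ ^ 2 * (lam + ζ / ν)}.encard ≤ 3 ∧
      ((dualRoot ν lam (‖σ x‖ ^ 2) 0).im = 0 ∧ 0 ≤ dualField ν lam σ 0 x) ∧
      ((dualRoot ν lam (‖σ x‖ ^ 2) 1).im = 0 →
        dualField ν lam σ 1 x ≤ 0 ∧ -(2 * ν * lam / 3) ≤ dualField ν lam σ 1 x) ∧
      ((dualRoot ν lam (‖σ x‖ ^ 2) 2).im = 0 →
        dualField ν lam σ 2 x ≤ -(2 * ν * lam / 3) ∧ -(ν * lam) ≤ dualField ν lam σ 2 x) ∧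
      (‖σ x‖ ^ 2 ≤ 8 * lam ^ 3 * ν ^ 2 / 27 →
        (dualRoot ν lam (‖σ x‖ ^ 2) 1).im = 0 ∧ (dualRoot ν lam (‖σ x‖ ^ 2) 2).im = 0)) ∧
    ∀ (i : Fin 3) (D : Set (Eucl n)), D ⊆ compatRegion Ω ν lam σ i →
      (∃ O : Set (Eucl n), IsOpen O ∧ D = closure Ω ∩ O) → IsConnected (D ∩ Ω) →
      ∀ x₀ ∈ D, ∀ c : ℝ,
        (IsSimplyConnected (D ∩ Ω) →
          ∃ u, IsPathIntegral D (strainField ν lam σ i) x₀ c u) ∧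
        ∀ u, IsPathIntegral D (strainField ν lam σ i) x₀ c u →
          u x₀ = c ∧
          ContDiffOn ℝ 1 u (D ∩ Ω) ∧
          SolvesDivBVP Ω Γu Γt p q f t D (fun x => stress ν lam (gradient u x)) ∧
          SolvesDivBVP Ω Γu Γt p q f t D (fun x => dualField ν lam σ i x • gradient u x) ∧
          (Ω ⊆ D → ∀ G g, IsAdmissible Ω Γu Γt p q u G g →
            IntegrableOn (fun x => doubleWell ν lam (G x)) Ω ∧
            IntegrableOn (dualDensity ν lam σ (dualField ν lam σ i)) Ω ∧
            primalEnergy Ω Γt ν lam f t u G g =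
              totalComplementaryEnergy Ω Γt ν lam f t u G g (dualField ν lam σ i) ∧
            primalEnergy Ω Γt ν lam f t u G g =
              dualEnergy Ω ν lam σ (dualField ν lam σ i)) := by
  constructor
  · intro x _
    have hs : 0 ≤ ‖σ x‖ ^ 2 := sq_nonneg _
    exact ⟨cubic_iff_dualRoot hν hlam hs, encard_real_cubic_le_three hν hlam hs,
      dualRoot_location hν hlam hs⟩
  rintro i D hD ⟨O, hO, hDO⟩ hconn x₀ hx₀ c
  have hDΩ : D ∩ Ω = Ω ∩ O := by
    rw [hDO]
    ext x
    exact ⟨fun h => ⟨h.2, h.1.2⟩, fun h => ⟨⟨subset_closure h.1, h.2⟩, h.1⟩⟩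
  have hUo : IsOpen (D ∩ Ω) := hDΩ ▸ hΩ_open.inter hO
  have hUD : D ∩ Ω ⊆ D := inter_subset_left
  have hDcl : D ⊆ closure Ω := fun x hx => (hD hx).1
  have hDm : MeasurableSet D := hDO ▸ isClosed_closure.measurableSet.inter hO.measurableSet
  have hacc : InwardAccessible (D ∩ Ω) D := by
    rw [hDΩ, hDO]
    exact hΩ_C1.inwardAccessible hΩ_open hO
  have hFc : ContinuousOn (strainField ν lam σ i) D := fun x hx =>
    (hD hx).2.2.2.1.continuousWithinAt.mono hDcl
  have hcl : ∀ x ∈ D ∩ Ω, closure Ω ∈ 𝓝 x := fun x hx =>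
    mem_of_superset (hΩ_open.mem_nhds hx.2) subset_closure
  refine ⟨fun hsc => ?_, fun u hu => ?_⟩
  · refine exists_isPathIntegral hFc hacc hUD hsc hUo (fun x hx =>
      ((hD hx.1).2.2.2.1.differentiableAt (hcl x hx)).differentiableWithinAt) ?_ x₀ c
    intro x hx j k
    have := (hD hx.1).2.2.2.2 j k
    rw [fderivWithin_of_mem_nhds (hcl x hx)] at this
    exact sub_eq_zero.1 this
  have hgrad : ∀ x ∈ D ∩ Ω, HasGradientAt u (strainField ν lam σ i x) x := fun x hx =>
    hu.hasGradientAt hFc hacc hUD hUo hconn.isPreconnected hx₀ hx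
  have hroot : ∀ x ∈ D, _ := fun x hx => compatRegion_root hν hlam (hD hx)
  refine ⟨hu.apply_base hx₀, contDiffOn_one_of_hasGradientAt hUo (hFc.mono hUD) hgrad,
    hσ.congr_on_subset hΩ_open hDcl hDm fun x hx => ?_,
    hσ.congr_on_subset hΩ_open hDcl hDm fun x hx => ?_, fun hΩD G g hadm => ?_⟩
  · obtain ⟨h0, h1⟩ := hroot x hx.1
    simp only [(hgrad x hx).gradient]
    exact (stress_smul hν.ne' h0 h1).2
  · obtain ⟨h0, -⟩ := hroot x hx.1
    simp only [(hgrad x hx).gradient, strainField]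
    rw [smul_smul, mul_inv_cancel₀ h0, one_smul]
  · refine integrable_and_no_duality_gap hΩ_bdd hν hpp' hf hσ hadm ?_
    have hG := hadm.weakGradient.ae_eq hΩ_open (hFc.mono hΩD) fun x hx => hgrad x ⟨hΩD hx, hx⟩
    filter_upwards [hG, ae_restrict_mem hΩ_open.measurableSet] with x hx hxΩ
    obtain ⟨h0, h1⟩ := hroot x (hΩD hxΩ)
    rw [hx]
    refine ⟨h0, ?_, (stress_smul hν.ne' h0 h1).1.symm⟩
    rw [strainField, smul_smul, mul_inv_cancel₀ h0, one_smul]
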